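/- Let $\vartheta:\mathbb R^8\to\mathbb R^2$ be the linear map sending the standard basis vectors $e_1,\dots,e_8$ to $(-1,0),(-1,-1),(0,-1),(1,-1),(1,0),(1,1),(0,1),(-1,1)$ respectively (the outer normals of an octagon), and let $N=\ker(\vartheta:\mathbb T^8\to\mathbb T^2)\cong\mathbb T^6$ be the kernel of the induced homomorphism of tori, acting on $\mathbb C^8$ as a subgroup of the standard torus $\mathbb T^8$, $(t\cdot z)_k=e^{it_k}z_k$. Let $\widetilde L^{-1}(0)\subset\mathbb C^8$ be the $N$-invariant level set given by $$|z_1|^2+|z_5|^2=6,\quad |z_2|^2+|z_5|^2+|z_7|^2=10,\quad |z_3|^2+|z_7|^2=6,$$ $$|z_4|^2-|z_5|^2+|z_7|^2=4,\quad |z_5|^2-|z_6|^2+|z_7|^2=2,\quad |z_5|^2-|z_7|^2+|z_8|^2=4,$$ let $M=\widetilde L^{-1}(0)/N$ with quotient map $\tau$, and let $\omega$ be the reduced symplectic form on $M$, characterized by $\tau^*\omega=\kappa^*\omega_{st}$, where $\kappa:\widetilde L^{-1}(0)\hookrightarrow\mathbb C^8$ is the inclusion and $\omega_{st}=-\frac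 i2\sum_{k=1}^8 dz_k\wedge d\bar z_k$. The smooth structure of $M$ is given by the eight charts $\psi_\nu$ $(\nu\in\mathbb Z/8)$, defined on $\{[z]\in M: z_k\ne0\text{ for }k\neq\nu,\nu+1\}$ by sending $[z]$ to $(w_\nu,w_{\nu+1})\in\mathbb C^2=\mathbb R^4$, where $w$ is the representative of $[z]$ with $w_k>0$ for all $k\ne\nu,\nu+1$. Define on $M$ the functions $$J([z])=\tfrac12|z_1|^2,\qquad H([z])=\tfrac12|z_3|^2,\qquad X([z])=\Re(\bar z_2\,\bar z_3\,\bar z_4\,z_6\,z_7\,z_8),$$ and, for $t,\gamma\in\mathbb R$, $H_t=(1-2t)H+t\gamma X$. Then $\omega$ does satisfy $\tau^*\omega=\kappa^*\omega_{st}$, and for all $t\in\mathbb R$ and all real $\gamma\neq0$ the map $F_t=(J,H_t):M\to\mathbb R^2$ is a completely integrable system on $(M,\omega)$. That is: $(M,\omega)$ is a $4$-dimensional symplectic manifold (a Hausdorff, second countable smooth manifold with a smooth, closed, nondegenerate $2$-form), $J$ and $H_t$ are smooth, they Poisson-commute (all brackets $\{f,g\}=-\omega(\mathcal X^{f},\mathcal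 X^{g})$ of $f,g\in\{J,H_t\}$ vanish, where $\omega(\mathcal X^f,\cdot)=df$), and the Hamiltonian vector fields $\mathcal X^{J}$ and $\mathcal X^{H_t}$ are linearly independent at almost every point of $M$. -/

import Mathlib

open Topology MeasureTheory
open scoped Manifold ContDiff

noncomputable section

/-! ### Symplectic manifolds, Hamiltonian vector fields and completely integrable systems -/

namespace SymplecticGeometry

section General

variable {E : Type*} [NormedAddCommGroup E] [NormedSpace ℝ E]
  {M : Type*} [TopologicalSpace M] [ChartedSpace E M]

/-- The coordinate expression of a `2`-form `Ω` on `M` in the chart `e`: the pullback of `Ω` under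
the inverse of `e`. -/
def inChart (Ω : ∀ p : M, TangentSpace 𝓘(ℝ, E) p [⋀^Fin 2]→L[ℝ] ℝ)
    (e : OpenPartialHomeomorph M E) (x : E) : E [⋀^Fin 2]→L[ℝ] ℝ :=
  (Ω (e.symm x)).compContinuousLinearMap (mfderiv 𝓘(ℝ, E) 𝓘(ℝ, E) e.symm x)

/-- `(M, Ω)` is a symplectic manifold: `M` is a smooth manifold (Hausdorff, second countable) and
`Ω` is a smooth, closed, nondegenerate `2`-form on `M`. -/
structure IsSymplecticManifold
    (Ω : ∀ p : M, TangentSpace 𝓘(ℝ, E) p [⋀^Fin 2]→L[ℝ] ℝ) : Prop where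
  t2 : T2Space M
  secondCountable : SecondCountableTopology M
  isManifold : IsManifold 𝓘(ℝ, E) ∞ M
  smooth : ∀ e ∈ atlas E M, ContDiffOn ℝ ∞ (inChart Ω e) e.target
  closed : ∀ e ∈ atlas E M, ∀ x ∈ e.target, extDeriv (inChart Ω e) x = 0
  nondegenerate : ∀ (p : M) (u : TangentSpace 𝓘(ℝ, E) p), (∀ v, Ω p ![u, v] = 0) → u = 0

/-- The differential of a real-valued function on `M`. -/
def differential (f : M → ℝ) (p : M) : TangentSpace 𝓘(ℝ, E) p →L[ℝ] ℝ :=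
  mfderiv 𝓘(ℝ, E) 𝓘(ℝ, ℝ) f p

/-- The Hamiltonian vector field `X` of `f`, i.e. the vector field with `Ω(X, ·) = df` (it exists
and is unique as soon as `Ω` is nondegenerate and `M` is finite-dimensional, see
`hamiltonianVectorField_spec`). -/
def hamiltonianVectorField (Ω : ∀ p : M, TangentSpace 𝓘(ℝ, E) p [⋀^Fin 2]→L[ℝ] ℝ)
    (f : M → ℝ) (p : M) : TangentSpace 𝓘(ℝ, E) p :=
  Classical.epsilon fun u => ∀ v, Ω p ![u, v] = differential f p v

/-- The Poisson bracket `{f, g} = -Ω(X_f, X_g)`. -/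
def poissonBracket (Ω : ∀ p : M, TangentSpace 𝓘(ℝ, E) p [⋀^Fin 2]→L[ℝ] ℝ)
    (f g : M → ℝ) (p : M) : ℝ :=
  -Ω p ![hamiltonianVectorField Ω f p, hamiltonianVectorField Ω g p]

variable (E) in
/-- A subset of a manifold is null if its image in every chart of the atlas is a null set for
Lebesgue measure, i.e. for the translation invariant measures on the (finite-dimensional) model
space, all of which are proportional. -/
def IsNull [MeasurableSpace E] [BorelSpace E] (S : Set M) : Prop :=
  ∀ e ∈ atlas E M, ∀ μ : Measure E, μ.IsAddHaarMeasure → μ (e '' (S ∩ e.source)) = 0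

/-- `(M, Ω, f)` is a `2n`-dimensional completely integrable system: `(M, Ω)` is a symplectic
manifold of dimension `2n`, and `f = (f₁, …, fₙ)` is smooth, its components pairwise
Poisson-commute, and their Hamiltonian vector fields are linearly independent almost everywhere. -/
structure IsCompletelyIntegrableSystem [MeasurableSpace E] [BorelSpace E] {n : ℕ}
    (Ω : ∀ p : M, TangentSpace 𝓘(ℝ, E) p [⋀^Fin 2]→L[ℝ] ℝ) (f : Fin n → M → ℝ) : Prop where
  finiteDimensional : FiniteDimensional ℝ E
  finrank_eq : Module.finrank ℝ E = 2 * n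
  symplectic : IsSymplecticManifold Ω
  smooth : ∀ i, ContMDiff 𝓘(ℝ, E) 𝓘(ℝ, ℝ) ∞ (f i)
  poisson_commute : ∀ i j p, poissonBracket Ω (f i) (f j) p = 0
  independent_ae :
    IsNull E {p : M | ¬ LinearIndependent ℝ fun i => hamiltonianVectorField Ω (f i) p}

theorem hamiltonianVectorField_spec [FiniteDimensional ℝ E]
    (Ω : ∀ p : M, TangentSpace 𝓘(ℝ, E) p [⋀^Fin 2]→L[ℝ] ℝ) (p : M)
    (hΩ : ∀ u : TangentSpace 𝓘(ℝ, E) p, (∀ v, Ω p ![u, v] = 0) → u = 0)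
    (f : M → ℝ) (v : TangentSpace 𝓘(ℝ, E) p) :
    Ω p ![hamiltonianVectorField Ω f p, v] = differential f p v := by
  have upd0 : ∀ x y z : TangentSpace 𝓘(ℝ, E) p, Function.update ![x, y] 0 z = ![z, y] := by
    intro x y z; funext i; fin_cases i <;> rfl
  have upd1 : ∀ x y z : TangentSpace 𝓘(ℝ, E) p, Function.update ![x, y] 1 z = ![x, z] := by
    intro x y z; funext i; fin_cases i <;> rfl
  have add0 : ∀ a b c : TangentSpace 𝓘(ℝ, E) p, Ω p ![a + b, c] = Ω p ![a, c] + Ω p ![b, c] :=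
    fun a b c => by simpa only [upd0] using (Ω p).map_update_add ![a, c] 0 a b
  have smul0 : ∀ (r : ℝ) (a c : TangentSpace 𝓘(ℝ, E) p), Ω p ![r • a, c] = r * Ω p ![a, c] :=
    fun r a c => by simpa only [upd0, smul_eq_mul] using (Ω p).map_update_smul ![a, c] 0 r a
  have add1 : ∀ a b c : TangentSpace 𝓘(ℝ, E) p, Ω p ![a, b + c] = Ω p ![a, b] + Ω p ![a, c] :=
    fun a b c => by simpa only [upd1] using (Ω p).map_update_add ![a, c] 1 b c
  have smul1 : ∀ (r : ℝ) (a c : TangentSpace 𝓘(ℝ, E) p), Ω p ![a, r • c] = r * Ω p ![a, c] :=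
    fun r a c => by simpa only [upd1, smul_eq_mul] using (Ω p).map_update_smul ![a, c] 1 r c
  let B : E →ₗ[ℝ] (E →ₗ[ℝ] ℝ) := LinearMap.mk₂ ℝ (fun u w : E => Ω p ![u, w])
    add0 smul0 add1 smul1
  have hB : Function.Injective B := by
    rw [← LinearMap.ker_eq_bot, LinearMap.ker_eq_bot']
    intro u hu
    exact hΩ u fun w => LinearMap.congr_fun hu w
  have hsurj : Function.Surjective B :=
    (LinearMap.injective_iff_surjective_of_finrank_eq_finrank
      (Subspace.dual_finrank_eq (K := ℝ) (V := E)).symm).1 hB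
  obtain ⟨u, hu⟩ := hsurj (differential f p : E →L[ℝ] ℝ).toLinearMap
  have hex : ∃ u : TangentSpace 𝓘(ℝ, E) p, ∀ w, Ω p ![u, w] = differential f p w :=
    ⟨u, fun w => LinearMap.congr_fun hu w⟩
  exact Classical.epsilon_spec hex v

end General

end SymplecticGeometry

/-! ### The toric symplectic manifold of the octagon, by Delzant's construction

The coordinates `z₁, …, z₈` of `ℂ⁸` are indexed by `Fin 8`, so `z₁` is `z 0`, …, `z₈` is `z 7`;
addition of indices is modulo `8`. -/

namespace Octagon

/-- The matrix of `ϑ : ℝ⁸ → ℝ²`; its columns are the outer normals of the edges of the octagon. -/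
def theta : Matrix (Fin 2) (Fin 8) ℤ :=
  !![-1, -1,  0,  1, 1, 1, 0, -1;
      0, -1, -1, -1, 0, 1, 1,  1]

/-- The matrix of `ℓ : ℝ⁶ → ℝ⁸`, which parametrizes the kernel of `ϑ`. -/
def ell : Matrix (Fin 8) (Fin 6) ℝ :=
  !![1, 0, 0,  0,  0,  0;
     0, 1, 0,  0,  0,  0;
     0, 0, 1,  0,  0,  0;
     0, 0, 0,  1,  0,  0;
     1, 1, 0, -1, -1,  1;
     0, 0, 0,  0,  1,  0;
     0, 1, 1,  1, -1, -1;
     0, 0, 0,  0,  0,  1]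

/-- The constants `c` of the eight half planes `⟨x, ϑ(e_k)⟩ ≤ c_k` that cut out the octagon. -/
def c : Fin 8 → ℝ := ![0, -1, 0, 2, 3, 5, 3, 2]

/-- The momentum map `L(z) = -½(|z₁|², …, |z₈|²) + c` of the standard `𝕋⁸`-action. -/
def L (z : Fin 8 → ℂ) : Fin 8 → ℝ := fun k => -(1 / 2) * ‖z k‖ ^ 2 + c k

/-- The momentum map `ℓ* ∘ L` of the action of `N` on `ℂ⁸`. -/
def Ltilde (z : Fin 8 → ℂ) : Fin 6 → ℝ := ell.transpose.mulVec (L z)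

/-- The level set `(ℓ* ∘ L)⁻¹(0)`. -/
def levelSet : Set (Fin 8 → ℂ) := {z | Ltilde z = 0}

/-- The homomorphism `𝕋⁸ → 𝕋²` induced by `ϑ`. -/
def thetaTorus : (Fin 8 → Circle) →* (Fin 2 → Circle) where
  toFun t i := ∏ k, t k ^ theta i k
  map_one' := by ext; simp
  map_mul' s t := by
    funext i
    simp [mul_zpow, Finset.prod_mul_distrib]

/-- The torus `N = ker (ϑ : 𝕋⁸ → 𝕋²)`. It acts on `ℂ⁸` by `(t • z)_k = t_k z_k`. -/
def N : Subgroup (Fin 8 → Circle) := thetaTorus.ker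

theorem norm_smul_apply (t : N) (z : Fin 8 → ℂ) (k : Fin 8) : ‖(t • z) k‖ = ‖z k‖ := by
  change ‖(t : Fin 8 → Circle) k • z k‖ = _
  exact Circle.norm_smul _ _

theorem smul_mem_levelSet (t : N) {z : Fin 8 → ℂ} (hz : z ∈ levelSet) : t • z ∈ levelSet := by
  have : L (t • z) = L z := by funext k; simp only [L, norm_smul_apply]
  simpa only [levelSet, Set.mem_ofPred_eq, Ltilde, this] using hz

instance : MulAction N levelSet where
  smul t z := ⟨t • (z : Fin 8 → ℂ), smul_mem_levelSet t z.2⟩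
  one_smul z := Subtype.ext (one_smul N (z : Fin 8 → ℂ))
  mul_smul s t z := Subtype.ext (mul_smul s t (z : Fin 8 → ℂ))

theorem coe_smul (t : N) (z : levelSet) : ((t • z : levelSet) : Fin 8 → ℂ) = t • (z : Fin 8 → ℂ) :=
  rfl

theorem smul_apply (t : N) (z : Fin 8 → ℂ) (k : Fin 8) :
    (t • z) k = ((t : Fin 8 → Circle) k : ℂ) * z k := rfl

instance : ContinuousConstSMul N levelSet where
  continuous_const_smul t := by
    refine Continuous.subtype_mk (continuous_pi fun k => ?_) _
    exact continuous_const.mul ((continuous_apply k).comp continuous_subtype_val)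

/-- The reduced space `M = (ℓ* ∘ L)⁻¹(0) / N`, with the quotient topology. -/
def M : Type := MulAction.orbitRel.Quotient N levelSet

instance : TopologicalSpace M :=
  inferInstanceAs (TopologicalSpace (MulAction.orbitRel.Quotient N levelSet))

/-- The quotient map `τ`, `τ(z) = [z]`. -/
def tau (z : levelSet) : M := Quotient.mk (MulAction.orbitRel N levelSet) z

theorem tau_smul (t : N) (z : levelSet) : tau (t • z) = tau z :=
  Quotient.sound (MulAction.orbitRel_apply.2 ⟨t, rfl⟩)

theorem isOpenMap_tau : IsOpenMap tau := isOpenMap_quotient_mk'_mul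

theorem isQuotientMap_tau : IsQuotientMap tau := isQuotientMap_quotient_mk'

/-- The function on `M` induced by an `N`-invariant function on `ℂ⁸`. -/
def descend {α : Type*} (f : (Fin 8 → ℂ) → α) (hf : ∀ (t : N) z, f (t • z) = f z) (p : M) : α :=
  Quotient.lift (fun z : levelSet => f z) (by
    rintro _ z ⟨t, rfl⟩
    exact hf t z) p

@[simp] theorem descend_tau {α : Type*} (f : (Fin 8 → ℂ) → α) (hf) (z : levelSet) :
    descend f hf (tau z) = f z := rfl

/-! #### The charts -/

/-- With `v_k = ϑ(e_k)`, the integers `a ν k` are the coefficients of `v_ν` in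
`v_k = a_k v_ν + b_k v_{ν+1}`. -/
def a (ν k : Fin 8) : ℤ := theta 0 k * theta 1 (ν + 1) - theta 1 k * theta 0 (ν + 1)

/-- The coefficients of `v_{ν+1}` in `v_k = a_k v_ν + b_k v_{ν+1}`. -/
def b (ν k : Fin 8) : ℤ := theta 0 ν * theta 1 k - theta 1 ν * theta 0 k

theorem theta_eq : ∀ (i : Fin 2) (ν k : Fin 8),
    theta i k = a ν k * theta i ν + b ν k * theta i (ν + 1) := by decide

theorem a_self : ∀ ν, a ν ν = 1 := by decide
theorem a_succ : ∀ ν, a ν (ν + 1) = 0 := by decide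
theorem b_self : ∀ ν, b ν ν = 0 := by decide
theorem b_succ : ∀ ν, b ν (ν + 1) = 1 := by decide

/-- The six indices other than `ν` and `ν + 1`. -/
def outer (ν : Fin 8) : Finset (Fin 8) := {k | k ≠ ν ∧ k ≠ ν + 1}

theorem mem_outer {ν k : Fin 8} : k ∈ outer ν ↔ k ≠ ν ∧ k ≠ ν + 1 := by simp [outer]

theorem prod_eq {G : Type*} [CommMonoid G] (ν : Fin 8) (f : Fin 8 → G) :
    ∏ k, f k = f ν * f (ν + 1) * ∏ k ∈ outer ν, f k := by
  have h1 : (Finset.univ : Finset (Fin 8)) = insert ν (insert (ν + 1) (outer ν)) := by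
    revert ν; decide
  have h2 : ν ∉ insert (ν + 1) (outer ν) := by revert ν; decide
  have h3 : ν + 1 ∉ outer ν := by simp [mem_outer]
  rw [h1, Finset.prod_insert h2, Finset.prod_insert h3, mul_assoc]

/-- In a point of the level set, `|z_k|²` is the value at `|z_ν|²` and `|z_{ν+1}|²` of this
function. -/
def radicand (ν k : Fin 8) (r s : ℝ) : ℝ :=
  2 * c k - a ν k * (2 * c ν - r) - b ν k * (2 * c (ν + 1) - s)

theorem mem_levelSet_iff {z : Fin 8 → ℂ} : z ∈ levelSet ↔
    ‖z 0‖ ^ 2 + ‖z 4‖ ^ 2 = 6 ∧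
    ‖z 1‖ ^ 2 + ‖z 4‖ ^ 2 + ‖z 6‖ ^ 2 = 10 ∧
    ‖z 2‖ ^ 2 + ‖z 6‖ ^ 2 = 6 ∧
    ‖z 3‖ ^ 2 - ‖z 4‖ ^ 2 + ‖z 6‖ ^ 2 = 4 ∧
    ‖z 4‖ ^ 2 - ‖z 5‖ ^ 2 + ‖z 6‖ ^ 2 = 2 ∧
    ‖z 4‖ ^ 2 - ‖z 6‖ ^ 2 + ‖z 7‖ ^ 2 = 4 := by
  rw [levelSet, Set.mem_ofPred_eq, funext_iff]
  simp [Fin.forall_fin_succ, Ltilde, Matrix.mulVec, dotProduct, Fin.sum_univ_eight, ell, L, c]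
  constructor
  · rintro ⟨h1, h2, h3, h4, h5, h6⟩
    refine ⟨?_, ?_, ?_, ?_, ?_, ?_⟩ <;> linarith
  · rintro ⟨h1, h2, h3, h4, h5, h6⟩
    refine ⟨?_, ?_, ?_, ?_, ?_, ?_⟩ <;> linarith

theorem radicand_eq {z : Fin 8 → ℂ} (hz : z ∈ levelSet) (ν k : Fin 8) :
    radicand ν k (‖z ν‖ ^ 2) (‖z (ν + 1)‖ ^ 2) = ‖z k‖ ^ 2 := by
  obtain ⟨h1, h2, h3, h4, h5, h6⟩ := mem_levelSet_iff.1 hz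
  fin_cases ν <;> fin_cases k <;> simp [radicand, a, b, theta, c] <;> linarith

theorem mem_levelSet_of_radicand {z : Fin 8 → ℂ} (ν : Fin 8)
    (h : ∀ k, ‖z k‖ ^ 2 = radicand ν k (‖z ν‖ ^ 2) (‖z (ν + 1)‖ ^ 2)) : z ∈ levelSet := by
  have h0 := h 0
  have h1 := h 1
  have h2 := h 2
  have h3 := h 3
  have h4 := h 4
  have h5 := h 5
  have h6 := h 6
  have h7 := h 7
  rw [mem_levelSet_iff]
  fin_cases ν <;> simp [radicand, a, b, theta, c] at h0 h1 h2 h3 h4 h5 h6 h7 <;>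
    refine ⟨?_, ?_, ?_, ?_, ?_, ?_⟩ <;> linarith

/-- The set `V_ν ⊆ ℂ² = ℝ⁴`, the image of the `ν`-th chart. -/
def V (ν : Fin 8) : Set (ℂ × ℂ) := {x | ∀ k ∈ outer ν, 0 < radicand ν k (‖x.1‖ ^ 2) (‖x.2‖ ^ 2)}

/-- The representative in `ℂ⁸` of the point with coordinates `x = (z_ν, z_{ν+1})` in the `ν`-th
chart: the other six coordinates are positive real numbers. -/
def localSection (ν : Fin 8) (x : ℂ × ℂ) : Fin 8 → ℂ := fun k =>
  if k = ν then x.1 else if k = ν + 1 then x.2 else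
    (√(radicand ν k (‖x.1‖ ^ 2) (‖x.2‖ ^ 2)) : ℂ)

/-- The `ν`-th coordinates of `[z]`: the pair `(w_ν, w_{ν+1})` for the representative `w` of `[z]`
all of whose other six coordinates are positive real numbers. -/
def coord (ν : Fin 8) (z : Fin 8 → ℂ) : ℂ × ℂ :=
  (z ν * ∏ k ∈ outer ν, (z k / ‖z k‖) ^ a ν k, z (ν + 1) * ∏ k ∈ outer ν, (z k / ‖z k‖) ^ b ν k)

theorem prod_theta (t : N) (i : Fin 2) : ∏ k, (t : Fin 8 → Circle) k ^ theta i k = 1 :=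
  congrFun (MonoidHom.mem_ker.1 t.2) i

theorem prod_a (t : N) (ν : Fin 8) : ∏ k, (t : Fin 8 → Circle) k ^ a ν k = 1 := by
  have h : ∀ k, (t : Fin 8 → Circle) k ^ a ν k = (((t : Fin 8 → Circle) k) ^ theta 0 k) ^
      theta 1 (ν + 1) * ((((t : Fin 8 → Circle) k) ^ theta 1 k) ^ theta 0 (ν + 1))⁻¹ := by
    intro k
    rw [← zpow_mul, ← zpow_mul, ← zpow_neg, ← zpow_add]
    rfl
  simp only [h, Finset.prod_mul_distrib, Finset.prod_zpow, Finset.prod_inv_distrib, prod_theta,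
    one_zpow, inv_one, mul_one]

theorem prod_b (t : N) (ν : Fin 8) : ∏ k, (t : Fin 8 → Circle) k ^ b ν k = 1 := by
  have h : ∀ k, (t : Fin 8 → Circle) k ^ b ν k = (((t : Fin 8 → Circle) k) ^ theta 1 k) ^
      theta 0 ν * ((((t : Fin 8 → Circle) k) ^ theta 0 k) ^ theta 1 ν)⁻¹ := by
    intro k
    rw [← zpow_mul, ← zpow_mul, ← zpow_neg, ← zpow_add, b]
    ring_nf
  simp only [h, Finset.prod_mul_distrib, Finset.prod_zpow, Finset.prod_inv_distrib, prod_theta,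
    one_zpow, inv_one, mul_one]

theorem prod_a' (t : N) (ν : Fin 8) :
    ((t : Fin 8 → Circle) ν : ℂ) * ∏ k ∈ outer ν, ((t : Fin 8 → Circle) k : ℂ) ^ a ν k = 1 := by
  have h := prod_a t ν
  rw [prod_eq ν, a_self, a_succ, zpow_one, zpow_zero, mul_one] at h
  have h' := congrArg (Circle.coeHom) h
  simp only [map_mul, map_prod, map_zpow, map_one] at h'
  exact h'

theorem prod_b' (t : N) (ν : Fin 8) :
    ((t : Fin 8 → Circle) (ν + 1) : ℂ) * ∏ k ∈ outer ν, ((t : Fin 8 → Circle) k : ℂ) ^ b ν k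
      = 1 := by
  have h := prod_b t ν
  rw [prod_eq ν, b_self, b_succ, zpow_one, zpow_zero, one_mul] at h
  have h' := congrArg (Circle.coeHom) h
  simp only [map_mul, map_prod, map_zpow, map_one] at h'
  exact h'

theorem coord_smul (ν : Fin 8) (t : N) (z : Fin 8 → ℂ) : coord ν (t • z) = coord ν z := by
  simp only [coord, norm_smul_apply]
  simp only [smul_apply, mul_div_assoc, mul_zpow, Finset.prod_mul_distrib]
  refine Prod.ext ?_ ?_
  · linear_combination (z ν * ∏ k ∈ outer ν, (z k / ‖z k‖) ^ a ν k) * prod_a' t ν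
  · linear_combination (z (ν + 1) * ∏ k ∈ outer ν, (z k / ‖z k‖) ^ b ν k) * prod_b' t ν

/-- The set `U_ν` of all `[z]` with `z_k ≠ 0` for `k ≠ ν, ν + 1`. -/
def U (ν : Fin 8) : Set M :=
  {p | descend (fun z => ∀ k ∈ outer ν, z k ≠ 0)
    (fun t z => by simp only [← norm_pos_iff, norm_smul_apply]) p}

theorem tau_mem_U {ν : Fin 8} {z : levelSet} :
    tau z ∈ U ν ↔ ∀ k ∈ outer ν, (z : Fin 8 → ℂ) k ≠ 0 := Iff.rfl

theorem localSection_self (ν : Fin 8) (x : ℂ × ℂ) : localSection ν x ν = x.1 := by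
  simp [localSection]

theorem localSection_succ (ν : Fin 8) (x : ℂ × ℂ) : localSection ν x (ν + 1) = x.2 := by
  simp [localSection]

theorem localSection_outer {ν k : Fin 8} (hk : k ∈ outer ν) (x : ℂ × ℂ) :
    localSection ν x k = (√(radicand ν k (‖x.1‖ ^ 2) (‖x.2‖ ^ 2)) : ℂ) := by
  rw [mem_outer] at hk
  simp [localSection, hk.1, hk.2]

theorem localSection_mem {ν : Fin 8} {x : ℂ × ℂ} (hx : x ∈ V ν) :
    localSection ν x ∈ levelSet := by
  refine mem_levelSet_of_radicand ν fun k => ?_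
  rw [localSection_self, localSection_succ]
  by_cases h1 : k = ν
  · subst h1
    simp [localSection_self, radicand, a_self, b_self]
  by_cases h2 : k = ν + 1
  · subst h2
    simp [localSection_succ, radicand, a_succ, b_succ]
  have hk : k ∈ outer ν := mem_outer.2 ⟨h1, h2⟩
  rw [localSection_outer hk, Complex.norm_real, Real.norm_eq_abs, sq_abs, Real.sq_sqrt (hx k hk).le]

instance : Nonempty M :=
  ⟨tau ⟨localSection 0 (0, 0), localSection_mem (by
    intro k hk
    fin_cases k <;> simp [radicand, a, b, theta, c, outer] at hk ⊢ <;> norm_num)⟩⟩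

theorem norm_coord {ν : Fin 8} {z : Fin 8 → ℂ} (hz : ∀ k ∈ outer ν, z k ≠ 0) :
    ‖(coord ν z).1‖ = ‖z ν‖ ∧ ‖(coord ν z).2‖ = ‖z (ν + 1)‖ := by
  have h : ∀ k ∈ outer ν, ‖z k / ‖z k‖‖ = 1 := by
    intro k hk
    have := norm_ne_zero_iff.2 (hz k hk)
    simp [this]
  constructor
  · rw [coord, norm_mul, norm_prod, Finset.prod_eq_one, mul_one]
    intro k hk
    rw [norm_zpow, h k hk, one_zpow]
  · rw [coord, norm_mul, norm_prod, Finset.prod_eq_one, mul_one]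
    intro k hk
    rw [norm_zpow, h k hk, one_zpow]

theorem coord_mem_V {ν : Fin 8} {z : Fin 8 → ℂ} (hzl : z ∈ levelSet)
    (hz : ∀ k ∈ outer ν, z k ≠ 0) : coord ν z ∈ V ν := by
  intro k hk
  rw [(norm_coord hz).1, (norm_coord hz).2, radicand_eq hzl]
  have := norm_pos_iff.2 (hz k hk)
  positivity

theorem localSection_ne_zero {ν : Fin 8} {x : ℂ × ℂ} (hx : x ∈ V ν) :
    ∀ k ∈ outer ν, localSection ν x k ≠ 0 := by
  intro k hk
  rw [localSection_outer hk]
  exact_mod_cast (Real.sqrt_pos.2 (hx k hk)).ne'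

theorem coord_localSection {ν : Fin 8} {x : ℂ × ℂ} (hx : x ∈ V ν) :
    coord ν (localSection ν x) = x := by
  have h : ∀ k ∈ outer ν, localSection ν x k / ‖localSection ν x k‖ = 1 := by
    intro k hk
    have h0 := localSection_ne_zero hx k hk
    rw [localSection_outer hk] at h0 ⊢
    rw [Complex.norm_real, Real.norm_eq_abs, abs_of_nonneg (Real.sqrt_nonneg _), div_self h0]
  refine Prod.ext ?_ ?_
  · simp only [coord]
    rw [localSection_self, Finset.prod_eq_one, mul_one]
    intro k hk
    rw [h k hk, one_zpow]
  · simp only [coord]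
    rw [localSection_succ, Finset.prod_eq_one, mul_one]
    intro k hk
    rw [h k hk, one_zpow]

/-- The element of `𝕋⁸` that makes the six outer coordinates of `z` positive. -/
def rotation (ν : Fin 8) (z : Fin 8 → ℂ) : Fin 8 → Circle := fun k =>
  if k = ν then ∏ j ∈ outer ν, Circle.exp (z j).arg ^ a ν j
  else if k = ν + 1 then ∏ j ∈ outer ν, Circle.exp (z j).arg ^ b ν j
  else (Circle.exp (z k).arg)⁻¹

theorem rotation_self (ν : Fin 8) (z : Fin 8 → ℂ) :
    rotation ν z ν = ∏ j ∈ outer ν, Circle.exp (z j).arg ^ a ν j := by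
  simp [rotation]

theorem rotation_succ (ν : Fin 8) (z : Fin 8 → ℂ) :
    rotation ν z (ν + 1) = ∏ j ∈ outer ν, Circle.exp (z j).arg ^ b ν j := by
  simp [rotation]

theorem rotation_outer {ν k : Fin 8} (hk : k ∈ outer ν) (z : Fin 8 → ℂ) :
    rotation ν z k = (Circle.exp (z k).arg)⁻¹ := by
  rw [mem_outer] at hk
  simp [rotation, hk.1, hk.2]

theorem rotation_mem (ν : Fin 8) (z : Fin 8 → ℂ) : rotation ν z ∈ N := by
  refine MonoidHom.mem_ker.2 (funext fun i => ?_)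
  change ∏ k, rotation ν z k ^ theta i k = 1
  rw [prod_eq ν, rotation_self, rotation_succ, ← Finset.prod_zpow, ← Finset.prod_zpow,
    ← Finset.prod_mul_distrib, ← Finset.prod_mul_distrib]
  refine Finset.prod_eq_one fun k hk => ?_
  rw [rotation_outer hk, theta_eq i ν k, ← zpow_mul, ← zpow_mul, ← zpow_add, inv_zpow,
    mul_inv_cancel]

theorem exp_arg {w : ℂ} (hw : w ≠ 0) : (Circle.exp w.arg : ℂ) = w / ‖w‖ := by
  have h : (‖w‖ : ℂ) ≠ 0 := by exact_mod_cast norm_ne_zero_iff.2 hw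
  rw [Circle.coe_exp, eq_div_iff h, mul_comm]
  exact Complex.norm_mul_exp_arg_mul_I w

theorem rotation_smul {ν : Fin 8} {z : Fin 8 → ℂ} (hzl : z ∈ levelSet)
    (hz : ∀ k ∈ outer ν, z k ≠ 0) :
    (⟨rotation ν z, rotation_mem ν z⟩ : N) • z = localSection ν (coord ν z) := by
  funext k
  change (rotation ν z k : ℂ) * z k = _
  by_cases h1 : k = ν
  · subst h1
    simp only [localSection_self, coord]
    rw [rotation_self, mul_comm]
    congr 1
    refine (map_prod Circle.coeHom _ _).trans (Finset.prod_congr rfl fun j hj => ?_)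
    rw [map_zpow]
    exact congrArg (· ^ _) (exp_arg (hz j hj))
  by_cases h2 : k = ν + 1
  · subst h2
    simp only [localSection_succ, coord]
    rw [rotation_succ, mul_comm]
    congr 1
    refine (map_prod Circle.coeHom _ _).trans (Finset.prod_congr rfl fun j hj => ?_)
    rw [map_zpow]
    exact congrArg (· ^ _) (exp_arg (hz j hj))
  have hk : k ∈ outer ν := mem_outer.2 ⟨h1, h2⟩
  rw [localSection_outer hk, (norm_coord hz).1, (norm_coord hz).2, radicand_eq hzl,
    Real.sqrt_sq (norm_nonneg _), rotation_outer hk, Circle.coe_inv, exp_arg (hz k hk), inv_div,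
    div_mul_cancel₀ _ (hz k hk)]

theorem isOpen_V (ν : Fin 8) : IsOpen (V ν) := by
  have : V ν = ⋂ k ∈ outer ν, {x : ℂ × ℂ | 0 < radicand ν k (‖x.1‖ ^ 2) (‖x.2‖ ^ 2)} := by
    ext x; simp [V]
  rw [this]
  refine isOpen_biInter_finset fun k _ => isOpen_lt continuous_const ?_
  unfold radicand
  fun_prop

theorem isOpen_U (ν : Fin 8) : IsOpen (U ν) := by
  rw [← isQuotientMap_tau.isOpen_preimage]
  have : tau ⁻¹' U ν = ⋂ k ∈ outer ν, {z : levelSet | (z : Fin 8 → ℂ) k ≠ 0} := by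
    ext z; simp [tau_mem_U]
  rw [this]
  exact isOpen_biInter_finset fun k _ =>
    isOpen_ne_fun ((continuous_apply k).comp continuous_subtype_val) continuous_const

theorem continuous_localSection (ν : Fin 8) : Continuous (localSection ν) := by
  refine continuous_pi fun k => ?_
  unfold localSection
  split_ifs
  · fun_prop
  · fun_prop
  · refine Complex.continuous_ofReal.comp (Real.continuous_sqrt.comp ?_)
    unfold radicand
    fun_prop

theorem continuousOn_coord (ν : Fin 8) :
    ContinuousOn (coord ν) {z | ∀ k ∈ outer ν, z k ≠ 0} := by
  have h : ∀ k ∈ outer ν, ∀ n : ℤ, ContinuousOn (fun z : Fin 8 → ℂ => (z k / ‖z k‖) ^ n)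
      {z | ∀ k ∈ outer ν, z k ≠ 0} := by
    intro k hk n z hz
    have h0 : z k ≠ 0 := hz k hk
    have h1 : (‖z k‖ : ℂ) ≠ 0 := by exact_mod_cast norm_ne_zero_iff.2 h0
    refine ContinuousAt.continuousWithinAt (ContinuousAt.zpow₀ ?_ n (Or.inl (div_ne_zero h0 h1)))
    exact ContinuousAt.div (continuous_apply k).continuousAt
      (Complex.continuous_ofReal.comp (continuous_norm.comp (continuous_apply k))).continuousAt h1
  refine ContinuousOn.prodMk ?_ ?_
  · exact (continuous_apply ν).continuousOn.mul (continuousOn_finsetProd _ fun k hk => h k hk _)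
  · exact (continuous_apply (ν + 1)).continuousOn.mul
      (continuousOn_finsetProd _ fun k hk => h k hk _)

open Classical in
/-- The chart `ψ_ν : U_ν → V_ν ⊆ ℂ² = ℝ⁴`. -/
def chart (ν : Fin 8) : OpenPartialHomeomorph M (ℂ × ℂ) where
  toFun := descend (coord ν) (coord_smul ν)
  invFun x := if hx : x ∈ V ν then tau ⟨localSection ν x, localSection_mem hx⟩
    else Classical.arbitrary M
  source := U ν
  target := V ν
  map_source' := by
    intro p hp
    obtain ⟨z, rfl⟩ := isQuotientMap_tau.surjective p
    exact coord_mem_V z.2 (tau_mem_U.1 hp)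
  map_target' := by
    intro x hx
    rw [dif_pos hx]
    exact tau_mem_U.2 (localSection_ne_zero hx)
  left_inv' := by
    intro p hp
    obtain ⟨z, rfl⟩ := isQuotientMap_tau.surjective p
    rw [descend_tau, dif_pos (coord_mem_V z.2 (tau_mem_U.1 hp))]
    exact (congrArg tau (Subtype.ext (rotation_smul z.2 (tau_mem_U.1 hp)).symm)).trans
      (tau_smul ⟨rotation ν z, rotation_mem ν z⟩ z)
  right_inv' := by
    intro x hx
    rw [dif_pos hx, descend_tau]
    exact coord_localSection hx
  open_source := isOpen_U ν
  open_target := isOpen_V ν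
  continuousOn_toFun := by
    rw [isQuotientMap_tau.continuousOn_isOpen_iff (isOpen_U ν)]
    exact (continuousOn_coord ν).comp continuous_subtype_val.continuousOn fun z hz => hz
  continuousOn_invFun := by
    rw [continuousOn_iff_continuous_domRestrict]
    have : (V ν).domRestrict (fun x => if hx : x ∈ V ν then
        tau ⟨localSection ν x, localSection_mem hx⟩ else Classical.arbitrary M) =
        fun x : V ν => tau ⟨localSection ν x, localSection_mem x.2⟩ := by
      funext x
      exact dif_pos x.2
    rw [this]
    exact isQuotientMap_tau.continuous.comp
      (((continuous_localSection ν).comp continuous_subtype_val).subtype_mk _)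

theorem exists_mem_U (p : M) : ∃ ν, p ∈ U ν := by
  obtain ⟨z, rfl⟩ := isQuotientMap_tau.surjective p
  simp only [tau_mem_U]
  obtain ⟨h1, h2, h3, h4, h5, h6⟩ := mem_levelSet_iff.1 z.2
  have key : ∀ k j : Fin 8, (z : Fin 8 → ℂ) k = 0 → j ≠ k → j ≠ k + 1 → j + 1 ≠ k →
      (z : Fin 8 → ℂ) j ≠ 0 := by
    intro k j hk d1 d2 d3 hj
    obtain ⟨r, hr⟩ : ∃ r : Fin 8 → ℝ, ∀ i, ‖(z : Fin 8 → ℂ) i‖ ^ 2 = r i := ⟨_, fun _ => rfl⟩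
    have h0 : ∀ i, 0 ≤ r i := fun i => by rw [← hr]; positivity
    have hk' : r k = 0 := by simp [← hr, hk]
    have hj' : r j = 0 := by simp [← hr, hj]
    simp only [hr] at h1 h2 h3 h4 h5 h6
    have n0 := h0 0
    have n1 := h0 1
    have n2 := h0 2
    have n3 := h0 3
    have n4 := h0 4
    have n5 := h0 5
    have n6 := h0 6
    have n7 := h0 7
    clear hk hj h0 hr
    fin_cases k <;> fin_cases j <;> simp at d1 d2 d3 <;> simp at hk' hj' <;> linarith
  by_cases hall : ∀ k, (z : Fin 8 → ℂ) k ≠ 0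
  · exact ⟨0, fun k _ => hall k⟩
  push Not at hall
  obtain ⟨k, hk⟩ := hall
  by_cases hk1 : (z : Fin 8 → ℂ) (k - 1) = 0
  · refine ⟨k - 1, fun j hj => ?_⟩
    obtain ⟨hj1, hj2⟩ := mem_outer.1 hj
    by_cases hj3 : j + 1 = k - 1
    · have aux : ∀ k j : Fin 8, j + 1 = k - 1 → j ≠ k ∧ j ≠ k + 1 ∧ j + 1 ≠ k := by decide
      obtain ⟨d1, d2, d3⟩ := aux k j hj3
      exact key k j hk d1 d2 d3
    · exact key _ j hk1 hj1 hj2 hj3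
  · refine ⟨k, fun j hj => ?_⟩
    obtain ⟨hj1, hj2⟩ := mem_outer.1 hj
    by_cases hj3 : j + 1 = k
    · rwa [show j = k - 1 from eq_sub_of_add_eq hj3]
    · exact key _ j hk hj1 hj2 hj3

/-- The index of a chart around `p`. -/
def chartIndex (p : M) : Fin 8 := (exists_mem_U p).choose

theorem mem_U_chartIndex (p : M) : p ∈ U (chartIndex p) := (exists_mem_U p).choose_spec

/-- The atlas of `M` consists of the eight charts `ψ_ν`. -/
instance : ChartedSpace (ℂ × ℂ) M where
  atlas := Set.range chart
  chartAt p := chart (chartIndex p)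
  mem_chart_source := mem_U_chartIndex
  chart_mem_atlas p := ⟨chartIndex p, rfl⟩

/-! #### The symplectic form -/

/-- The standard symplectic form `ω_st = -(i/2) ∑ dz_k ∧ dz̄_k = -∑ dx_k ∧ dy_k` on `ℂ⁸`. -/
def omegaSt : (Fin 8 → ℂ) [⋀^Fin 2]→L[ℝ] ℝ where
  toFun w := ∑ k, -((w 0 k).re * (w 1 k).im - (w 0 k).im * (w 1 k).re)
  map_update_add' w i x y := by
    rw [← Finset.sum_add_distrib]
    refine Finset.sum_congr rfl fun k _ => ?_
    fin_cases i <;> simp <;> ring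
  map_update_smul' w i r x := by
    rw [smul_eq_mul, Finset.mul_sum]
    refine Finset.sum_congr rfl fun k _ => ?_
    fin_cases i <;> simp <;> ring
  map_eq_zero_of_eq' w i j h hij := by
    refine Finset.sum_eq_zero fun k _ => ?_
    have : w 0 = w 1 := by
      fin_cases i <;> fin_cases j <;> simp_all
    rw [this]
    ring
  cont := by
    change Continuous fun w : Fin 2 → Fin 8 → ℂ =>
      ∑ k, -((w 0 k).re * (w 1 k).im - (w 0 k).im * (w 1 k).re)
    fun_prop

/-- The reduced symplectic form `ω` on `M`: at `p`, in the preferred chart `ψ_ν` around `p` (which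
identifies `T_p M` with `ℂ²`), it is the pullback of `ω_st` under the local section
`V_ν → (ℓ* ∘ L)⁻¹(0) ⊆ ℂ⁸` of the quotient map. -/
def omega (p : M) : TangentSpace 𝓘(ℝ, ℂ × ℂ) p [⋀^Fin 2]→L[ℝ] ℝ :=
  omegaSt.compContinuousLinearMap
    (fderiv ℝ (localSection (chartIndex p)) (chart (chartIndex p) p) : ℂ × ℂ →L[ℝ] (Fin 8 → ℂ))

/-- The defining property `τ* Ω = κ* ω_st` of the reduced form, where `κ` is the inclusion of the
level set into `ℂ⁸`: for every smooth map `g` from the plane into `ℂ⁸` with values in the level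
set, `τ ∘ g` is smooth and `(τ ∘ g)* Ω = g* ω_st`. As the level set is a submanifold, every pair of
tangent vectors of it is obtained from such a map. -/
def IsReducedForm (Ω : ∀ p : M, TangentSpace 𝓘(ℝ, ℂ × ℂ) p [⋀^Fin 2]→L[ℝ] ℝ) : Prop :=
  ∀ g : ℝ × ℝ → levelSet, ContDiff ℝ ∞ (fun x => (g x : Fin 8 → ℂ)) →
    ContMDiff 𝓘(ℝ, ℝ × ℝ) 𝓘(ℝ, ℂ × ℂ) ∞ (fun x => tau (g x)) ∧
    ∀ x u v : ℝ × ℝ,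
      Ω (tau (g x)) ![mfderiv 𝓘(ℝ, ℝ × ℝ) 𝓘(ℝ, ℂ × ℂ) (fun x => tau (g x)) x u,
          mfderiv 𝓘(ℝ, ℝ × ℝ) 𝓘(ℝ, ℂ × ℂ) (fun x => tau (g x)) x v] =
        omegaSt ![fderiv ℝ (fun x => (g x : Fin 8 → ℂ)) x u,
          fderiv ℝ (fun x => (g x : Fin 8 → ℂ)) x v]

/-! #### The functions on `M` -/

/-- `J([z]) = ½|z₁|²`. -/
def J : M → ℝ := descend (fun z => 1 / 2 * ‖z 0‖ ^ 2) fun t z => by simp only [norm_smul_apply]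

/-- `H([z]) = ½|z₃|²`. -/
def H : M → ℝ := descend (fun z => 1 / 2 * ‖z 2‖ ^ 2) fun t z => by simp only [norm_smul_apply]

/-- `Z(z) = z̄₂ z̄₃ z̄₄ z₆ z₇ z₈`. -/
def Z (z : Fin 8 → ℂ) : ℂ :=
  star (z 1) * star (z 2) * star (z 3) * z 5 * z 6 * z 7

theorem Z_smul (t : N) (z : Fin 8 → ℂ) : Z (t • z) = Z z := by
  have h := congrArg Circle.coeHom (prod_theta t 1)
  simp [Fin.prod_univ_eight, theta] at h
  have e' : ∀ k, Circle.coeHom ((t : Fin 8 → Circle) k) = ((t : Fin 8 → Circle) k : ℂ) :=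
    fun k => rfl
  simp only [e'] at h
  have e : ∀ k, star ((t : Fin 8 → Circle) k : ℂ) = ((t : Fin 8 → Circle) k : ℂ)⁻¹ := fun k => by
    rw [← Circle.coe_inv, Circle.coe_inv_eq_conj]; rfl
  simp only [Z, smul_apply, star_mul, e]
  linear_combination (star (z 1) * star (z 2) * star (z 3) * z 5 * z 6 * z 7) * h

/-- `X([z]) = Re Z(z)`. -/
def X : M → ℝ := descend (fun z => (Z z).re) fun t z => by rw [Z_smul]

/-- `H_t = (1 - 2t) H + t γ X`. -/
def Ht (t γ : ℝ) : M → ℝ := fun p => (1 - 2 * t) * H p + t * γ * X p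

end Octagon
end

noncomputable section

namespace Octagon

/-! ### Topology of the reduced space -/

/-! The torus `N` is compact, so it acts properly and `M` is Hausdorff; second countability passes
to the quotient by a group action.

In polar coordinates `dx ∧ dy = d(½r²) ∧ dθ`. On the level set each `|z_k|²` is an affine function
of `|z_ν|²` and `|z_{ν+1}|²` with linear coefficients `a ν k`, `b ν k`. The same integers are the
exponents with which the phases of the outer coordinates enter `coord ν`. Hence `∑ d(½r_k²) ∧ dθ_k`
regroups into the two area forms of the chart coordinates: on vectors tangent to the level set,
`coord ν` pulls the constant form `modelForm` back to `ω_st` (`modelForm_fderiv_coord`). All eight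
charts are thus Darboux charts for one and the same constant form. This gives `τ*ω = κ*ω_st` as well
as smoothness, closedness and nondegeneracy of `ω`.

The Hamiltonian vector field of `½|z_j|²` is induced by the rotation of `z_j`
(`hamiltonianVectorField_halfNormSq`). Neither `|z₃|²` nor `Z` involves `z₁`, so `H_t` is constant
along the flow of `J`, and the two functions commute.

Where no coordinate vanishes, the rotations of `z₁` and `z₃` give independent fields, since the
normals `v₁`, `v₃` have determinant 1. This settles `t = 0`. For `t ≠ 0`, rotating `z₃` leaves `J`
fixed and changes `H_t` at the rate `tγ Im Z`, so the fields of `J` and `H_t` are independent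
wherever moreover `Im Z ≠ 0` (`linearIndependent_hamiltonianVectorField`). In each chart `Z` is a
real factor times `x₁`, `x₂`, `x₁x₂` or a conjugate of one of these, so the excluded points lie in
the null set `exceptionalSet`. -/

theorem continuous_thetaTorus : Continuous thetaTorus := by
  change Continuous fun (t : Fin 8 → Circle) (i : Fin 2) => ∏ k, t k ^ theta i k
  fun_prop

instance : CompactSpace N := by
  have h : IsClosed (N : Set (Fin 8 → Circle)) :=
    isClosed_singleton.preimage continuous_thetaTorus
  exact isCompact_iff_compactSpace.1 h.isCompact

instance : ContinuousSMul N levelSet where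
  continuous_smul := by
    refine Continuous.subtype_mk (continuous_pi fun k => ?_) _
    change Continuous fun p : N × levelSet =>
      (((p.1 : Fin 8 → Circle) k : Circle) : ℂ) * (p.2 : Fin 8 → ℂ) k
    exact (continuous_subtype_val.comp
      ((continuous_apply k).comp (continuous_subtype_val.comp continuous_fst))).mul
      ((continuous_apply k).comp (continuous_subtype_val.comp continuous_snd))

/-- Every ultrafilter on the compact group `N` converges, which is all that the ultrafilter
criterion for properness asks for. -/
instance : ProperSMul N levelSet := by
  rw [properSMul_iff_continuousSMul_ultrafilter_tendsto_t2]
  refine ⟨inferInstance, fun 𝒰 x₁ x₂ _ => ?_⟩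
  obtain ⟨g, -, hg⟩ := isCompact_univ.ultrafilter_le_nhds (𝒰.map Prod.fst) (by simp)
  exact ⟨g, hg⟩

instance : T2Space M := t2Space_quotient_mulAction_of_properSMul (G := N) (X := levelSet)

instance : SecondCountableTopology M :=
  ContinuousConstSMul.secondCountableTopology (Γ := N) (T := levelSet)

/-! ### Differentials of the local sections and of the coordinates -/

theorem contDiffAt_localSection {ν : Fin 8} {x : ℂ × ℂ} (hx : x ∈ V ν) :
    ContDiffAt ℝ ∞ (localSection ν) x := by
  refine contDiffAt_pi.2 fun k => ?_
  by_cases h1 : k = ν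
  · subst h1
    simp only [localSection_self]
    exact contDiffAt_fst
  by_cases h2 : k = ν + 1
  · subst h2
    simp only [localSection_succ]
    exact contDiffAt_snd
  have hk : k ∈ outer ν := mem_outer.2 ⟨h1, h2⟩
  simp only [localSection_outer hk]
  refine Complex.ofRealCLM.contDiff.contDiffAt.comp x (ContDiffAt.sqrt ?_ (hx k hk).ne')
  have h : ContDiff ℝ ∞ fun x : ℂ × ℂ => radicand ν k (‖x.1‖ ^ 2) (‖x.2‖ ^ 2) := by
    unfold radicand
    have h1 := (contDiff_fst (𝕜 := ℝ) (E := ℂ) (F := ℂ) (n := ∞)).norm_sq ℝ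
    have h2 := (contDiff_snd (𝕜 := ℝ) (E := ℂ) (F := ℂ) (n := ∞)).norm_sq ℝ
    fun_prop
  exact h.contDiffAt

theorem contDiffAt_coord {ν : Fin 8} {z : Fin 8 → ℂ} (hz : ∀ k ∈ outer ν, z k ≠ 0) :
    ContDiffAt ℝ ∞ (coord ν) z := by
  have hu : ∀ k ∈ outer ν, ∀ n : ℤ,
      ContDiffAt ℝ ∞ (fun z : Fin 8 → ℂ => (z k / ‖z k‖) ^ n) z := by
    intro k hk n
    have h0 := hz k hk
    have h1 : (‖z k‖ : ℂ) ≠ 0 := by exact_mod_cast norm_ne_zero_iff.2 h0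
    have hk : ContDiffAt ℝ ∞ (fun z : Fin 8 → ℂ => z k) z := (contDiff_apply ℝ ℂ k).contDiffAt
    have hb : ContDiffAt ℝ ∞ (fun z : Fin 8 → ℂ => z k / ‖z k‖) z := by
      simp only [div_eq_mul_inv]
      exact hk.mul ((Complex.ofRealCLM.contDiff.contDiffAt.comp z (hk.norm ℝ h0)).inv h1)
    obtain ⟨m, rfl | rfl⟩ := n.eq_nat_or_neg
    · simpa using hb.pow m
    · simp only [zpow_neg, zpow_natCast]
      exact (hb.pow m).inv (pow_ne_zero m (div_ne_zero h0 h1))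
  unfold coord
  exact ((contDiff_apply ℝ ℂ ν).contDiffAt.mul (contDiffAt_prod fun k hk => hu k hk _)).prodMk
    ((contDiff_apply ℝ ℂ (ν + 1)).contDiffAt.mul (contDiffAt_prod fun k hk => hu k hk _))

/-- The differential of the argument of `z_k`. -/
def dArg (k : Fin 8) (z : Fin 8 → ℂ) : (Fin 8 → ℂ) →L[ℝ] ℝ :=
  Complex.imCLM ∘L ((z k)⁻¹ • (ContinuousLinearMap.proj k : (Fin 8 → ℂ) →L[ℝ] ℂ))

theorem dArg_apply (k : Fin 8) (z v : Fin 8 → ℂ) : dArg k z v = (v k / z k).im := by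
  simp [dArg, div_eq_inv_mul]

/-- The differential of a map into `ℂ` with constant modulus, value `w` and phase of
differential `θ`. -/
def dPhase {E : Type*} [NormedAddCommGroup E] [NormedSpace ℝ E] (w : ℂ) (θ : E →L[ℝ] ℝ) :
    E →L[ℝ] ℂ :=
  (w * Complex.I) • (Complex.ofRealCLM ∘L θ)

theorem dPhase_apply {E : Type*} [NormedAddCommGroup E] [NormedSpace ℝ E] (w : ℂ)
    (θ : E →L[ℝ] ℝ) (v : E) : dPhase w θ v = w * Complex.I * θ v := by
  simp [dPhase]

/-! ### Calculus of phases: products add the differentials, powers scale them. -/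

section Phase

variable {E : Type*} [NormedAddCommGroup E] [NormedSpace ℝ E] {x : E}

theorem hasFDerivAt_phase_mul {f g : E → ℂ} {θ η : E →L[ℝ] ℝ}
    (hf : HasFDerivAt f (dPhase (f x) θ) x) (hg : HasFDerivAt g (dPhase (g x) η) x) :
    HasFDerivAt (fun y => f y * g y) (dPhase (f x * g x) (θ + η)) x := by
  refine (hf.mul hg).congr_fderiv ?_
  ext v
  simp [dPhase_apply]
  ring

theorem hasFDerivAt_phase_prod {ι : Type*} (s : Finset ι) {f : ι → E → ℂ}
    {θ : ι → E →L[ℝ] ℝ} (hf : ∀ k ∈ s, HasFDerivAt (f k) (dPhase (f k x) (θ k)) x) :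
    HasFDerivAt (fun y => ∏ k ∈ s, f k y) (dPhase (∏ k ∈ s, f k x) (∑ k ∈ s, θ k)) x := by
  classical
  induction s using Finset.induction_on with
  | empty =>
    simp only [Finset.prod_empty, Finset.sum_empty]
    refine (hasFDerivAt_const 1 x).congr_fderiv ?_
    ext v
    simp [dPhase_apply]
  | insert k s hk ih =>
    simp only [Finset.prod_insert hk, Finset.sum_insert hk]
    exact hasFDerivAt_phase_mul (hf k (s.mem_insert_self k))
      (ih fun j hj => hf j (Finset.mem_insert_of_mem hj))

theorem hasFDerivAt_phase_zpow {f : E → ℂ} {θ : E →L[ℝ] ℝ} (hx : f x ≠ 0)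
    (hf : HasFDerivAt f (dPhase (f x) θ) x) (n : ℤ) :
    HasFDerivAt (fun y => f y ^ n) (dPhase (f x ^ n) ((n : ℝ) • θ)) x := by
  refine ((hasDerivAt_zpow n (f x) (Or.inl hx)).comp_hasFDerivAt x hf).congr_fderiv ?_
  ext v
  have : f x ^ (n - 1) * f x = f x ^ n := by rw [← zpow_add_one₀ hx, sub_add_cancel]
  simp [dPhase_apply]
  linear_combination (n * Complex.I * θ v) * this

end Phase

theorem hasFDerivAt_div_norm {z : Fin 8 → ℂ} {k : Fin 8} (hk : z k ≠ 0) :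
    HasFDerivAt (fun z : Fin 8 → ℂ => z k / ‖z k‖) (dPhase (z k / ‖z k‖) (dArg k z)) z := by
  have hn : (‖z k‖ : ℂ) ≠ 0 := by exact_mod_cast norm_ne_zero_iff.2 hk
  have hp : HasFDerivAt (fun z : Fin 8 → ℂ => z k)
      (ContinuousLinearMap.proj k : (Fin 8 → ℂ) →L[ℝ] ℂ) z := hasFDerivAt_apply k z
  have hq := hp.norm_sq.sqrt (pow_ne_zero 2 (norm_ne_zero_iff.2 hk))
  simp only [Real.sqrt_sq (norm_nonneg _)] at hq
  have hi := (hasDerivAt_inv hn).comp_hasFDerivAt z (Complex.ofRealCLM.hasFDerivAt.comp z hq)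
  simp only [div_eq_mul_inv]
  refine (hp.mul hi).congr_fderiv ?_
  ext v
  -- In the logarithmic increment `w = v_k / z_k`, `Re w` is the relative change of the modulus and
  -- `Im w` that of the argument; dividing by the modulus removes `Re w`.
  obtain ⟨w, hw⟩ : ∃ w, v k = z k * w := ⟨v k / z k, by field_simp⟩
  have hr : inner ℝ (z k) (z k * w) = ‖z k‖ ^ 2 * w.re := by
    rw [Complex.inner, mul_right_comm, Complex.mul_conj',
      ← Complex.ofReal_pow, Complex.re_ofReal_mul]
  have hd : dArg k z v = w.im := by rw [dArg_apply, hw, mul_div_cancel_left₀ _ hk]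
  simp [dPhase_apply, -Complex.inner, hr, hd, hw]
  field_simp
  linear_combination (-1 : ℂ) * (Complex.re_add_im w)

/-! ### The pullback of the standard form -/

theorem sum_eq {G : Type*} [AddCommMonoid G] (ν : Fin 8) (f : Fin 8 → G) :
    ∑ k, f k = f ν + f (ν + 1) + ∑ k ∈ outer ν, f k :=
  prod_eq (G := Multiplicative G) ν f

/-- The area form `dx ∧ dy` of `ℂ`. -/
def cross (p q : ℂ) : ℝ := p.re * q.im - p.im * q.re

/-- The form `-(dx₁ ∧ dy₁ + dx₂ ∧ dy₂)` on `ℂ²`. -/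
def modelForm (u v : ℂ × ℂ) : ℝ := -(cross u.1 v.1 + cross u.2 v.2)

theorem omegaSt_apply (u v : Fin 8 → ℂ) : omegaSt ![u, v] = -∑ k, cross (u k) (v k) := by
  rw [← Finset.sum_neg_distrib]
  rfl

theorem cross_mul_mul (w p q : ℂ) : cross (w * p) (w * q) = ‖w‖ ^ 2 * cross p q := by
  rw [Complex.sq_norm, Complex.normSq_apply]
  simp only [cross, Complex.mul_re, Complex.mul_im]
  ring

theorem cross_add_phase (z p q : ℂ) (r s : ℝ) :
    cross (p + z * Complex.I * r) (q + z * Complex.I * s) =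
      cross p q + (inner ℝ z p * s - r * inner ℝ z q) := by
  simp [cross, Complex.inner]
  ring

/-- This is `dx ∧ dy = d(½r²) ∧ dθ`: the differential of `½r²` is `inner ℝ z`, that of `θ` is `p ↦
Im (p / z)`. -/
theorem cross_eq_inner_mul_arg {z : ℂ} (hz : z ≠ 0) (p q : ℂ) :
    cross p q = inner ℝ z p * (q / z).im - (p / z).im * inner ℝ z q := by
  have hp : p = z * (p / z) := by field_simp
  have hq : q = z * (q / z) := by field_simp
  have hi : ∀ w : ℂ, inner ℝ z (z * w) = ‖z‖ ^ 2 * w.re := fun w => by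
    rw [Complex.inner, mul_right_comm, Complex.mul_conj', ← Complex.ofReal_pow,
      Complex.re_ofReal_mul]
  generalize p / z = p' at *
  generalize q / z = q' at *
  rw [hp, hq, cross_mul_mul, hi, hi, cross]
  ring

/-- The linearization at `z` of the equations `|z_k|² = a_k |z_ν|² + b_k |z_{ν+1}|² + const`. -/
def IsTangent (ν : Fin 8) (z v : Fin 8 → ℂ) : Prop :=
  ∀ k, inner ℝ (z k) (v k) =
    a ν k * inner ℝ (z ν) (v ν) + b ν k * inner ℝ (z (ν + 1)) (v (ν + 1))

theorem isTangent_fderiv {E : Type*} [NormedAddCommGroup E] [NormedSpace ℝ E]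
    {g : E → Fin 8 → ℂ} {x : E} (hg : DifferentiableAt ℝ g x)
    (hl : ∀ᶠ y in 𝓝 x, g y ∈ levelSet) (ν : Fin 8) (u : E) :
    IsTangent ν (g x) (fderiv ℝ g x u) := by
  intro k
  have hk : ∀ j, HasFDerivAt (fun y => ‖g y j‖ ^ 2)
      (2 • (innerSL ℝ (g x j)).comp ((ContinuousLinearMap.proj j).comp (fderiv ℝ g x))) x :=
    fun j => ((hasFDerivAt_apply (𝕜 := ℝ) j (g x)).comp x hg.hasFDerivAt).norm_sq
  -- Near `x` the function `|g_k|²` is given by `radicand`, so its differential can be computed in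
  -- two ways.
  have h1 : HasFDerivAt (fun y => ‖g y k‖ ^ 2) _ x :=
    ((((hk ν).const_sub (2 * c ν)).const_mul (a ν k : ℝ)).const_sub (2 * c k) |>.sub
      (((hk (ν + 1)).const_sub (2 * c (ν + 1))).const_mul (b ν k : ℝ))).congr_of_eventuallyEq
      (hl.mono fun y hy => (radicand_eq hy ν k).symm)
  have h2 := DFunLike.congr_fun (h1.unique (hk k)) u
  simp [-Complex.inner] at h2
  linarith

theorem fderiv_coord {ν : Fin 8} {z : Fin 8 → ℂ} (hz : ∀ k ∈ outer ν, z k ≠ 0)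
    (v : Fin 8 → ℂ) : fderiv ℝ (coord ν) z v =
      ((∏ k ∈ outer ν, (z k / ‖z k‖) ^ a ν k) *
        (v ν + z ν * Complex.I * (∑ k ∈ outer ν, a ν k * dArg k z v : ℝ)),
      (∏ k ∈ outer ν, (z k / ‖z k‖) ^ b ν k) *
        (v (ν + 1) + z (ν + 1) * Complex.I * (∑ k ∈ outer ν, b ν k * dArg k z v : ℝ))) := by
  have hn : ∀ k ∈ outer ν, z k / (‖z k‖ : ℂ) ≠ 0 := fun k hk =>
    div_ne_zero (hz k hk) (by exact_mod_cast norm_ne_zero_iff.2 (hz k hk))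
  have hp : ∀ n : Fin 8 → ℤ, HasFDerivAt
      (fun z : Fin 8 → ℂ => ∏ k ∈ outer ν, (z k / ‖z k‖) ^ n k)
      (dPhase (∏ k ∈ outer ν, (z k / ‖z k‖) ^ n k) (∑ k ∈ outer ν, (n k : ℝ) • dArg k z)) z :=
    fun n => hasFDerivAt_phase_prod (outer ν) fun k hk =>
      hasFDerivAt_phase_zpow (f := fun z : Fin 8 → ℂ => z k / ‖z k‖) (hn k hk)
        (hasFDerivAt_div_norm (hz k hk)) (n k)
  have h := ((hasFDerivAt_apply (𝕜 := ℝ) ν z).mul (hp (a ν))).prodMk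
    ((hasFDerivAt_apply (𝕜 := ℝ) (ν + 1) z).mul (hp (b ν)))
  rw [HasFDerivAt.fderiv (f := coord ν) h]
  ext1
  · simp [dPhase_apply]
    ring
  · simp [dPhase_apply]
    ring

theorem norm_prod_phase {ν : Fin 8} {z : Fin 8 → ℂ} (hz : ∀ k ∈ outer ν, z k ≠ 0)
    (n : Fin 8 → ℤ) : ‖∏ k ∈ outer ν, (z k / ‖z k‖) ^ n k‖ = 1 := by
  rw [norm_prod, Finset.prod_eq_one]
  intro k hk
  have := norm_ne_zero_iff.2 (hz k hk)
  simp [this]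

/-- The heart of the reduction. The unimodular factors in `fderiv_coord` do not affect areas, and
the infinitesimal rotations there add terms `d(½r_ν²) ∧ a_k dθ_k` and `d(½r_{ν+1}²) ∧ b_k dθ_k`. By
tangency their sum for a given `k` is `d(½r_k²) ∧ dθ_k`, the area form of the outer coordinate
`z_k`. -/
theorem modelForm_fderiv_coord {ν : Fin 8} {z : Fin 8 → ℂ} (hz : ∀ k ∈ outer ν, z k ≠ 0)
    {u v : Fin 8 → ℂ} (hu : IsTangent ν z u) (hv : IsTangent ν z v) :
    modelForm (fderiv ℝ (coord ν) z u) (fderiv ℝ (coord ν) z v) = omegaSt ![u, v] := by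
  rw [fderiv_coord hz, fderiv_coord hz, omegaSt_apply, sum_eq ν, modelForm]
  simp only [cross_mul_mul, norm_prod_phase hz, one_pow, one_mul, cross_add_phase]
  have h : ∑ k ∈ outer ν, cross (u k) (v k) =
      (inner ℝ (z ν) (u ν) * (∑ k ∈ outer ν, a ν k * dArg k z v) -
        (∑ k ∈ outer ν, a ν k * dArg k z u) * inner ℝ (z ν) (v ν)) +
      (inner ℝ (z (ν + 1)) (u (ν + 1)) * (∑ k ∈ outer ν, b ν k * dArg k z v) -
        (∑ k ∈ outer ν, b ν k * dArg k z u) * inner ℝ (z (ν + 1)) (v (ν + 1))) := by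
    simp only [Finset.mul_sum, Finset.sum_mul, ← Finset.sum_sub_distrib, ← Finset.sum_add_distrib]
    refine Finset.sum_congr rfl fun k hk => ?_
    rw [cross_eq_inner_mul_arg (hz k hk), hu k, hv k, dArg_apply, dArg_apply]
    ring
  rw [h]
  ring

theorem fderiv_localSection_apply {ν : Fin 8} {x : ℂ × ℂ} (hx : x ∈ V ν) (u : ℂ × ℂ) :
    fderiv ℝ (localSection ν) x u ν = u.1 ∧ fderiv ℝ (localSection ν) x u (ν + 1) = u.2 ∧
      ∀ k ∈ outer ν, (fderiv ℝ (localSection ν) x u k).im = 0 := by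
  have hd := ((contDiffAt_localSection hx).differentiableAt (by simp)).hasFDerivAt
  have hk : ∀ k, HasFDerivAt (fun y => localSection ν y k)
      ((ContinuousLinearMap.proj k).comp (fderiv ℝ (localSection ν) x)) x := fun k =>
    (hasFDerivAt_apply (𝕜 := ℝ) k (localSection ν x)).comp x hd
  refine ⟨?_, ?_, fun k hko => ?_⟩
  · have h := hk ν
    simp only [localSection_self] at h
    exact (DFunLike.congr_fun (hasFDerivAt_fst.unique h) u).symm
  · have h := hk (ν + 1)
    simp only [localSection_succ] at h
    exact (DFunLike.congr_fun (hasFDerivAt_snd.unique h) u).symm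
  · have h := Complex.imCLM.hasFDerivAt.comp x (hk k)
    have h' : (Complex.imCLM ∘ fun y => localSection ν y k) = fun _ => (0 : ℝ) := by
      funext y
      simp [localSection_outer hko]
    rw [h'] at h
    exact (DFunLike.congr_fun ((hasFDerivAt_const _ _).unique h) u).symm

/-- The outer coordinates of the section are real, so their area forms vanish. -/
theorem omegaSt_fderiv_localSection {ν : Fin 8} {x : ℂ × ℂ} (hx : x ∈ V ν) (u v : ℂ × ℂ) :
    omegaSt ![fderiv ℝ (localSection ν) x u, fderiv ℝ (localSection ν) x v] = modelForm u v := by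
  obtain ⟨u1, u2, u3⟩ := fderiv_localSection_apply hx u
  obtain ⟨v1, v2, v3⟩ := fderiv_localSection_apply hx v
  rw [omegaSt_apply, sum_eq ν, u1, u2, v1, v2, Finset.sum_eq_zero, add_zero, modelForm]
  intro k hk
  rw [cross, u3 k hk, v3 k hk]
  ring

/-! ### The symplectic manifold `M` -/

theorem chart_symm_apply {ν : Fin 8} {x : ℂ × ℂ} (hx : x ∈ V ν) :
    (chart ν).symm x = tau ⟨localSection ν x, localSection_mem hx⟩ := dif_pos hx

theorem chart_tau (ν : Fin 8) (z : levelSet) : chart ν (tau z) = coord ν z := rfl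

theorem chart_symm_coord {ν : Fin 8} {z : Fin 8 → ℂ} (hz : z ∈ levelSet)
    (hk : ∀ k ∈ outer ν, z k ≠ 0) : (chart ν).symm (coord ν z) = tau ⟨z, hz⟩ :=
  (chart ν).left_inv (x := tau ⟨z, hz⟩) hk

/-! ### Maps `f` into `M` that near `x` have a lift `g` to the level set. -/

section Lift

variable {E : Type*} {f : E → M} {g : E → Fin 8 → ℂ} {x : E}

section

variable [TopologicalSpace E]

theorem ne_zero_of_lift (hfg : ∀ᶠ y in 𝓝 x, ∃ h : g y ∈ levelSet, f y = tau ⟨g y, h⟩)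
    {k : Fin 8} (hk : k ∈ outer (chartIndex (f x))) : g x k ≠ 0 := by
  obtain ⟨h, hf⟩ := hfg.self_of_nhds
  have hU := mem_U_chartIndex (f x)
  generalize chartIndex (f x) = ν at *
  rw [hf] at hU
  exact tau_mem_U.1 hU k hk

theorem chart_comp_eventuallyEq
    (hfg : ∀ᶠ y in 𝓝 x, ∃ h : g y ∈ levelSet, f y = tau ⟨g y, h⟩) (ν : Fin 8) :
    chart ν ∘ f =ᶠ[𝓝 x] coord ν ∘ g := by
  filter_upwards [hfg] with y ⟨h, hf⟩
  rw [Function.comp_apply, hf, chart_tau, Function.comp_apply]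

/-- The nonvanishing of the outer coordinates is an open condition, so near `x` the map `f` is the
inverse chart composed with `coord ν ∘ g`. -/
theorem continuousAt_of_lift (hg : ContinuousAt g x)
    (hfg : ∀ᶠ y in 𝓝 x, ∃ h : g y ∈ levelSet, f y = tau ⟨g y, h⟩) : ContinuousAt f x := by
  set ν := chartIndex (f x) with hν
  have hz : ∀ k ∈ outer ν, g x k ≠ 0 := fun k hk => ne_zero_of_lift hfg hk
  obtain ⟨hx, -⟩ := hfg.self_of_nhds
  have h0 : ContinuousAt (coord ν ∘ g) x := (contDiffAt_coord hz).continuousAt.comp hg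
  have h1 : ContinuousAt ((chart ν).symm ∘ coord ν ∘ g) x :=
    ContinuousAt.comp (g := (chart ν).symm)
      ((chart ν).symm.continuousAt (coord_mem_V hx hz)) h0
  refine h1.congr ?_
  have hz' : ∀ᶠ y in 𝓝 x, ∀ k ∈ outer ν, g y k ≠ 0 :=
    (Filter.eventually_all_finset _).2 fun k hk =>
      ((continuous_apply k).continuousAt.comp hg).eventually_ne (hz k hk)
  filter_upwards [hfg, hz'] with y ⟨h, hf⟩ hy
  rw [hf]
  exact chart_symm_coord h hy

end

variable [NormedAddCommGroup E] [NormedSpace ℝ E]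

theorem contMDiffAt_of_lift (hg : ContDiffAt ℝ ∞ g x)
    (hfg : ∀ᶠ y in 𝓝 x, ∃ h : g y ∈ levelSet, f y = tau ⟨g y, h⟩) :
    ContMDiffAt 𝓘(ℝ, E) 𝓘(ℝ, ℂ × ℂ) ∞ f x := by
  refine contMDiffAt_iff.2 ⟨continuousAt_of_lift hg.continuousAt hfg, ?_⟩
  simp only [mfld_simps, contDiffWithinAt_univ]
  exact ((contDiffAt_coord fun k hk => ne_zero_of_lift hfg hk).comp x hg).congr_of_eventuallyEq
    (chart_comp_eventuallyEq hfg (chartIndex (f x)))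

theorem mfderiv_of_lift (hg : ContDiffAt ℝ ∞ g x)
    (hfg : ∀ᶠ y in 𝓝 x, ∃ h : g y ∈ levelSet, f y = tau ⟨g y, h⟩) :
    mfderiv 𝓘(ℝ, E) 𝓘(ℝ, ℂ × ℂ) f x =
      (fderiv ℝ (coord (chartIndex (f x))) (g x)).comp (fderiv ℝ g x) := by
  refine ((contMDiffAt_of_lift hg hfg).mdifferentiableAt (by simp)).mfderiv.trans ?_
  simp only [mfld_simps, fderivWithin_univ]
  refine (chart_comp_eventuallyEq hfg (chartIndex (f x))).fderiv_eq.trans ?_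
  exact fderiv_comp x ((contDiffAt_coord fun k hk =>
    ne_zero_of_lift hfg hk).differentiableAt (by simp)) (hg.differentiableAt (by simp))

end Lift

theorem chart_mem_V {ν : Fin 8} {p : M} (hp : p ∈ U ν) : chart ν p ∈ V ν :=
  (chart ν).map_source hp

theorem omega_apply (p : M) (u v : TangentSpace 𝓘(ℝ, ℂ × ℂ) p) :
    omega p ![u, v] = modelForm u v := by
  have h := omegaSt_fderiv_localSection (chart_mem_V (mem_U_chartIndex p)) u v
  rw [← h]
  change omegaSt (fun i => fderiv ℝ (localSection (chartIndex p)) (chart (chartIndex p) p)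
    ((![u, v] : Fin 2 → ℂ × ℂ) i)) = _
  congr 1
  funext i
  fin_cases i <;> rfl

/-- Serves twice: with an arbitrary smooth `g` it yields `τ*ω = κ*ω_st`, and with `g` a local
section it computes `omega` in every chart, not only in the preferred one. -/
theorem omega_mfderiv {E : Type*} [NormedAddCommGroup E] [NormedSpace ℝ E] {f : E → M}
    {g : E → Fin 8 → ℂ} {x : E} (hg : ContDiffAt ℝ ∞ g x)
    (hfg : ∀ᶠ y in 𝓝 x, ∃ h : g y ∈ levelSet, f y = tau ⟨g y, h⟩) (u v : E) :
    omega (f x) ![mfderiv 𝓘(ℝ, E) 𝓘(ℝ, ℂ × ℂ) f x u, mfderiv 𝓘(ℝ, E) 𝓘(ℝ, ℂ × ℂ) f x v] =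
      omegaSt ![fderiv ℝ g x u, fderiv ℝ g x v] := by
  have hl : ∀ᶠ y in 𝓝 x, g y ∈ levelSet := hfg.mono fun y hy => hy.1
  have hd := hg.differentiableAt (by simp)
  rw [omega_apply, mfderiv_of_lift hg hfg]
  exact modelForm_fderiv_coord (fun k hk => ne_zero_of_lift hfg hk)
    (isTangent_fderiv hd hl _ u) (isTangent_fderiv hd hl _ v)

theorem isReducedForm_omega : IsReducedForm omega := by
  intro g hg
  have h : ∀ x, ∀ᶠ y in 𝓝 x, ∃ h : (g y : Fin 8 → ℂ) ∈ levelSet,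
      tau (g y) = tau ⟨(g y : Fin 8 → ℂ), h⟩ := fun x => Filter.Eventually.of_forall fun y =>
    ⟨(g y).2, rfl⟩
  exact ⟨fun x => contMDiffAt_of_lift (f := fun x => tau (g x)) hg.contDiffAt (h x),
    fun x u v => omega_mfderiv (f := fun x => tau (g x)) hg.contDiffAt (h x) u v⟩

theorem chart_symm_lift {ν : Fin 8} {x : ℂ × ℂ} (hx : x ∈ V ν) :
    ∀ᶠ y in 𝓝 x, ∃ h : localSection ν y ∈ levelSet,
      (chart ν).symm y = tau ⟨localSection ν y, h⟩ := by
  filter_upwards [(isOpen_V ν).mem_nhds hx] with y hy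
  exact ⟨localSection_mem hy, chart_symm_apply hy⟩

instance isManifold : IsManifold 𝓘(ℝ, ℂ × ℂ) ∞ M := by
  refine isManifold_of_contDiffOn _ _ _ ?_
  rintro _ _ ⟨ν, rfl⟩ ⟨μ, rfl⟩
  simp only [mfld_simps]
  rintro x ⟨hx, hx'⟩
  have hx : x ∈ V ν := hx
  rw [Set.mem_preimage, chart_symm_apply hx] at hx'
  have h := (contDiffAt_coord (tau_mem_U.1 hx')).comp x (contDiffAt_localSection hx)
  exact (h.congr_of_eventuallyEq
    (chart_comp_eventuallyEq (chart_symm_lift hx) μ)).contDiffWithinAt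

theorem inChart_omega_apply {ν : Fin 8} {x : ℂ × ℂ} (hx : x ∈ V ν) (u v : ℂ × ℂ) :
    SymplecticGeometry.inChart omega (chart ν) x ![u, v] = modelForm u v := by
  rw [← omegaSt_fderiv_localSection hx,
    ← omega_mfderiv (contDiffAt_localSection hx) (chart_symm_lift hx),
    SymplecticGeometry.inChart]
  refine (ContinuousAlternatingMap.compContinuousLinearMap_apply _ _ _).trans ?_
  congr 1
  funext i
  fin_cases i <;> rfl

/-- Constancy in each chart makes smoothness and closedness immediate. -/
theorem inChart_omega_eq {ν : Fin 8} {x y : ℂ × ℂ} (hx : x ∈ V ν) (hy : y ∈ V ν) :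
    SymplecticGeometry.inChart omega (chart ν) x =
      SymplecticGeometry.inChart omega (chart ν) y := by
  ext w
  have hw : w = ![w 0, w 1] := by
    funext i
    fin_cases i <;> rfl
  rw [hw, inChart_omega_apply hx, inChart_omega_apply hy]

theorem eq_zero_of_modelForm {u : ℂ × ℂ} (h : ∀ v, modelForm u v = 0) : u = 0 := by
  have h1 := h (1, 0)
  have h2 := h (Complex.I, 0)
  have h3 := h (0, 1)
  have h4 := h (0, Complex.I)
  simp [modelForm, cross] at h1 h2 h3 h4
  exact Prod.ext (Complex.ext h2 h1) (Complex.ext h4 h3)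

theorem isSymplecticManifold_omega : SymplecticGeometry.IsSymplecticManifold omega where
  t2 := inferInstance
  secondCountable := inferInstance
  isManifold := isManifold
  smooth := by
    rintro _ ⟨ν, rfl⟩ x hx
    exact contDiffWithinAt_const.congr (fun y hy => inChart_omega_eq hy hx) rfl
  closed := by
    rintro _ ⟨ν, rfl⟩ x hx
    have h : SymplecticGeometry.inChart omega (chart ν) =ᶠ[𝓝 x]
        fun _ => SymplecticGeometry.inChart omega (chart ν) x :=
      Filter.eventually_of_mem ((isOpen_V ν).mem_nhds hx) fun y hy => inChart_omega_eq hy hx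
    rw [h.extDeriv_eq]
    rw [extDeriv, fderiv_const_apply]
    exact map_zero (ContinuousAlternatingMap.alternatizeUncurryFinCLM ℝ (ℂ × ℂ) ℝ)
  nondegenerate p u h := eq_zero_of_modelForm fun v => by rw [← omega_apply p u v, h v]

/-! ### Differentials and Hamiltonian vector fields of the functions on `M` -/

/-- The representative in `ℂ⁸` of `p` singled out by the preferred chart around `p`. -/
def rep (p : M) : Fin 8 → ℂ := localSection (chartIndex p) (chart (chartIndex p) p)

/-- The differential at `p` of the local section belonging to the preferred chart around `p`. -/
def dRep (p : M) : ℂ × ℂ →L[ℝ] (Fin 8 → ℂ) :=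
  fderiv ℝ (localSection (chartIndex p)) (chart (chartIndex p) p)

theorem chart_mem (p : M) : chart (chartIndex p) p ∈ V (chartIndex p) :=
  chart_mem_V (mem_U_chartIndex p)

theorem rep_mem (p : M) : rep p ∈ levelSet := localSection_mem (chart_mem p)

theorem rep_ne_zero (p : M) : ∀ k ∈ outer (chartIndex p), rep p k ≠ 0 :=
  localSection_ne_zero (chart_mem p)

theorem tau_rep (p : M) : tau ⟨rep p, rep_mem p⟩ = p :=
  (chart_symm_apply (chart_mem p)).symm.trans
    ((chart (chartIndex p)).left_inv (mem_U_chartIndex p))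

theorem coord_rep (p : M) : coord (chartIndex p) (rep p) = chart (chartIndex p) p :=
  coord_localSection (chart_mem p)

theorem fderiv_coord_dRep (p : M) (v : ℂ × ℂ) :
    fderiv ℝ (coord (chartIndex p)) (rep p) (dRep p v) = v := by
  have h1 := ((contDiffAt_coord (rep_ne_zero p)).differentiableAt (by simp)).hasFDerivAt.comp
    (chart (chartIndex p) p)
    ((contDiffAt_localSection (chart_mem p)).differentiableAt (by simp)).hasFDerivAt
  have h2 : coord (chartIndex p) ∘ localSection (chartIndex p) =ᶠ[𝓝 (chart (chartIndex p) p)] id :=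
    Filter.eventually_of_mem ((isOpen_V _).mem_nhds (chart_mem p)) fun y hy =>
      coord_localSection hy
  exact DFunLike.congr_fun ((h1.congr_of_eventuallyEq h2.symm).unique (hasFDerivAt_id _)) v

theorem isTangent_dRep (p : M) (v : ℂ × ℂ) : IsTangent (chartIndex p) (rep p) (dRep p v) :=
  isTangent_fderiv ((contDiffAt_localSection (chart_mem p)).differentiableAt (by simp))
    (Filter.eventually_of_mem ((isOpen_V _).mem_nhds (chart_mem p)) fun _ hy =>
      localSection_mem hy) _ v

/-! ### Smoothness and differentials of functions induced by `N`-invariant functions. -/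

section Descend

variable {F : (Fin 8 → ℂ) → ℝ} (hF : ∀ (t : N) z, F (t • z) = F z)

theorem continuous_descend (hc : Continuous F) : Continuous (descend F hF) :=
  isQuotientMap_tau.continuous_iff.2 (hc.comp continuous_subtype_val)

theorem descend_comp_chart_symm (p : M) :
    descend F hF ∘ (chart (chartIndex p)).symm =ᶠ[𝓝 (chart (chartIndex p) p)]
      F ∘ localSection (chartIndex p) := by
  filter_upwards [(isOpen_V _).mem_nhds (chart_mem p)] with y hy
  rw [Function.comp_apply, chart_symm_apply hy, descend_tau, Function.comp_apply]

theorem contMDiff_descend (hs : ContDiff ℝ ∞ F) :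
    ContMDiff 𝓘(ℝ, ℂ × ℂ) 𝓘(ℝ, ℝ) ∞ (descend F hF) := by
  intro p
  refine contMDiffAt_iff.2 ⟨(continuous_descend hF hs.continuous).continuousAt, ?_⟩
  simp only [mfld_simps, contDiffWithinAt_univ]
  exact (hs.contDiffAt.comp _ (contDiffAt_localSection (chart_mem p))).congr_of_eventuallyEq
    (descend_comp_chart_symm hF p)

theorem differential_descend (hs : ContDiff ℝ ∞ F) (p : M) (v : TangentSpace 𝓘(ℝ, ℂ × ℂ) p) :
    SymplecticGeometry.differential (descend F hF) p v = fderiv ℝ F (rep p) (dRep p v) := by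
  have h1 := ((contMDiff_descend hF hs p).mdifferentiableAt (by simp)).mfderiv
  simp only [mfld_simps, fderivWithin_univ] at h1
  have h2 := (descend_comp_chart_symm hF p).fderiv_eq.trans (fderiv_comp _
    (hs.differentiable (by simp)).differentiableAt
    ((contDiffAt_localSection (chart_mem p)).differentiableAt (by simp)))
  exact DFunLike.congr_fun (h1.trans h2) v

end Descend

/-! ### Rotations of single coordinates and the vector fields they induce on `M`. -/

/-- The rotation of the `j`-th coordinate. -/
def rotate (j : Fin 8) (z : Fin 8 → ℂ) (s : ℝ) : Fin 8 → ℂ :=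
  Function.update z j (Complex.exp (s * Complex.I) * z j)

theorem rotate_self (j : Fin 8) (z : Fin 8 → ℂ) (s : ℝ) :
    rotate j z s j = Complex.exp (s * Complex.I) * z j := by
  simp [rotate]

theorem rotate_of_ne {j k : Fin 8} (h : k ≠ j) (z : Fin 8 → ℂ) (s : ℝ) :
    rotate j z s k = z k := by
  simp [rotate, h]

theorem rotate_zero (j : Fin 8) (z : Fin 8 → ℂ) : rotate j z 0 = z := by simp [rotate]

theorem norm_rotate (j : Fin 8) (z : Fin 8 → ℂ) (s : ℝ) (k : Fin 8) :
    ‖rotate j z s k‖ = ‖z k‖ := by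
  by_cases h : k = j
  · subst h
    rw [rotate_self, norm_mul, Complex.norm_exp_ofReal_mul_I, one_mul]
  · rw [rotate_of_ne h]

theorem rotate_mem {z : Fin 8 → ℂ} (hz : z ∈ levelSet) (j : Fin 8) (s : ℝ) :
    rotate j z s ∈ levelSet := by
  rw [mem_levelSet_iff] at hz ⊢
  simpa only [norm_rotate] using hz

theorem hasDerivAt_exp_mul_I (w : ℂ) :
    HasDerivAt (fun s : ℝ => Complex.exp (s * Complex.I) * w) (Complex.I * w) 0 := by
  have h : HasDerivAt (fun s : ℝ => (s : ℂ) * Complex.I) (1 * Complex.I) 0 :=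
    (Complex.ofRealCLM.hasDerivAt (x := (0 : ℝ))).mul_const Complex.I
  simpa using h.cexp.mul_const w

theorem hasDerivAt_rotate (j : Fin 8) (z : Fin 8 → ℂ) :
    HasDerivAt (rotate j z) (Pi.single j (Complex.I * z j)) 0 := by
  refine hasDerivAt_pi.2 fun k => ?_
  by_cases h : k = j
  · subst h
    simpa only [rotate_self, Pi.single_eq_same] using hasDerivAt_exp_mul_I (z k)
  · simpa only [rotate_of_ne h, Pi.single_eq_of_ne h] using hasDerivAt_const 0 (z k)

/-- The vector field on `M` induced by the rotation of the `j`-th coordinate of `ℂ⁸`. -/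
def rotationField (j : Fin 8) (p : M) : TangentSpace 𝓘(ℝ, ℂ × ℂ) p :=
  (fderiv ℝ (coord (chartIndex p)) (rep p) (Pi.single j (Complex.I * rep p j)) : ℂ × ℂ)

theorem inner_I_mul_self (z : ℂ) : inner ℝ z (Complex.I * z) = (0 : ℝ) := by
  simp [Complex.inner]
  ring

theorem isTangent_rotation (ν j : Fin 8) (z : Fin 8 → ℂ) :
    IsTangent ν z (Pi.single j (Complex.I * z j)) := by
  have h : ∀ k, inner ℝ (z k) ((Pi.single j (Complex.I * z j) : Fin 8 → ℂ) k) = (0 : ℝ) := by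
    intro k
    by_cases h : k = j
    · subst h
      rw [Pi.single_eq_same, inner_I_mul_self]
    · rw [Pi.single_eq_of_ne h, inner_zero_right]
  intro k
  simp only [h, mul_zero, add_zero]

/-- Passing to the chart and back by the local section replaces the rotated point by another point
of its `N`-orbit, where the invariant function `F` has the same value. The derivative can therefore
be taken along the rotation in `ℂ⁸`. -/
theorem differential_rotationField {F : (Fin 8 → ℂ) → ℝ} (hF : ∀ (t : N) z, F (t • z) = F z)
    (hs : ContDiff ℝ ∞ F) (j : Fin 8) (p : M) {D : ℝ}
    (hD : HasDerivAt (fun s => F (rotate j (rep p) s)) D 0) :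
    SymplecticGeometry.differential (descend F hF) p (rotationField j p) = D := by
  rw [differential_descend hF hs]
  have hr := hasDerivAt_rotate j (rep p)
  have hne : ∀ s, ∀ k ∈ outer (chartIndex p), rotate j (rep p) s k ≠ 0 := fun s k hk => by
    rw [← norm_pos_iff, norm_rotate, norm_pos_iff]
    exact rep_ne_zero p k hk
  have h1 : HasDerivAt (coord (chartIndex p) ∘ rotate j (rep p)) (rotationField j p : ℂ × ℂ) 0 := by
    refine HasFDerivAt.comp_hasDerivAt 0 ?_ hr
    rw [rotate_zero]
    exact ((contDiffAt_coord (rep_ne_zero p)).differentiableAt (by simp)).hasFDerivAt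
  have h2 : HasDerivAt (localSection (chartIndex p) ∘ coord (chartIndex p) ∘ rotate j (rep p))
      (dRep p (rotationField j p)) 0 := by
    refine HasFDerivAt.comp_hasDerivAt 0 ?_ h1
    rw [Function.comp_apply, rotate_zero, coord_rep]
    exact ((contDiffAt_localSection (chart_mem p)).differentiableAt (by simp)).hasFDerivAt
  have h3 : HasDerivAt
      (F ∘ localSection (chartIndex p) ∘ coord (chartIndex p) ∘ rotate j (rep p))
      (fderiv ℝ F (rep p) (dRep p (rotationField j p))) 0 := by
    refine HasFDerivAt.comp_hasDerivAt 0 ?_ h2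
    rw [Function.comp_apply, Function.comp_apply, rotate_zero, coord_rep]
    exact (hs.differentiable (by simp)).differentiableAt.hasFDerivAt
  have h4 : (F ∘ localSection (chartIndex p) ∘ coord (chartIndex p) ∘ rotate j (rep p)) =
      fun s => F (rotate j (rep p) s) := by
    funext s
    simp only [Function.comp_apply]
    rw [← rotation_smul (rotate_mem (rep_mem p) j s) (hne s), hF]
  rw [h4] at h3
  exact h3.unique hD

theorem modelForm_sub_left (u u' v : ℂ × ℂ) :
    modelForm (u - u') v = modelForm u v - modelForm u' v := by
  simp [modelForm, cross]
  ring

theorem modelForm_swap (u v : ℂ × ℂ) : modelForm u v = -modelForm v u := by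
  simp [modelForm, cross]
  ring

theorem modelForm_self (u : ℂ × ℂ) : modelForm u u = 0 := by
  simp [modelForm, cross]
  ring

theorem modelForm_hamiltonianVectorField (f : M → ℝ) (p : M) (v : TangentSpace 𝓘(ℝ, ℂ × ℂ) p) :
    modelForm (SymplecticGeometry.hamiltonianVectorField omega f p) v =
      SymplecticGeometry.differential f p v := by
  rw [← omega_apply]
  exact SymplecticGeometry.hamiltonianVectorField_spec omega p
    (isSymplecticManifold_omega.nondegenerate p) f v

/-- The function `½|z_j|²` on `M`. -/
def halfNormSq (j : Fin 8) : M → ℝ :=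
  descend (fun z => 1 / 2 * ‖z j‖ ^ 2) fun t z => by simp only [norm_smul_apply]

theorem contDiff_half_norm_sq (j : Fin 8) :
    ContDiff ℝ ∞ fun z : Fin 8 → ℂ => 1 / 2 * ‖z j‖ ^ 2 :=
  contDiff_const.mul ((contDiff_apply ℝ ℂ j).norm_sq ℝ)

theorem cross_I_mul (z w : ℂ) : cross (Complex.I * z) w = -inner ℝ z w := by
  simp [cross, Complex.inner]
  ring

/-- The sign of `ω_st = -∑ dx_k ∧ dy_k` makes `ω_st(i z_j, ·) = ⟨z_j, ·⟩ = d(½|z_j|²)`. Rotation is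
tangent to the level set, so `modelForm_fderiv_coord` carries this identity down to `M`;
nondegeneracy then identifies the fields. -/
theorem hamiltonianVectorField_halfNormSq (j : Fin 8) (p : M) :
    SymplecticGeometry.hamiltonianVectorField omega (halfNormSq j) p = rotationField j p := by
  refine sub_eq_zero.1 (eq_zero_of_modelForm (u := _ - _) fun v => ?_)
  refine (modelForm_sub_left _ _ v).trans (sub_eq_zero.2 ?_)
  refine (modelForm_hamiltonianVectorField (halfNormSq j) p v).trans ?_
  refine (differential_descend _ (contDiff_half_norm_sq j) p v).trans ?_
  have h1 : HasFDerivAt (fun z : Fin 8 → ℂ => 1 / 2 * ‖z j‖ ^ 2) _ (rep p) :=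
    (hasFDerivAt_apply (𝕜 := ℝ) j (rep p)).norm_sq.const_mul (1 / 2)
  have h2 := modelForm_fderiv_coord (rep_ne_zero p) (isTangent_rotation _ j (rep p))
    (isTangent_dRep p v)
  rw [fderiv_coord_dRep] at h2
  refine Eq.trans ?_ h2.symm
  rw [h1.fderiv, omegaSt_apply, Finset.sum_eq_single j, Pi.single_eq_same, cross_I_mul]
  · simp [-Complex.inner]
  · intro k _ hk
    rw [Pi.single_eq_of_ne hk]
    simp [cross]
  · simp

/-- On `M`, rotating `z_j` at unit speed rotates the two chart coordinates at speeds `a_j` and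
`b_j`. For `j = ν, ν + 1` the speeds are `(1, 0)` and `(0, 1)`, so one formula covers all `j`. -/
theorem rotationField_eq (j : Fin 8) (p : M) : rotationField j p =
    ((∏ k ∈ outer (chartIndex p), (rep p k / ‖rep p k‖) ^ a (chartIndex p) k) *
        (a (chartIndex p) j * (Complex.I * rep p (chartIndex p))),
      (∏ k ∈ outer (chartIndex p), (rep p k / ‖rep p k‖) ^ b (chartIndex p) k) *
        (b (chartIndex p) j * (Complex.I * rep p (chartIndex p + 1)))) := by
  refine (fderiv_coord (rep_ne_zero p) _).trans ?_
  have hne := rep_ne_zero p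
  generalize rep p = z at *
  generalize chartIndex p = ν at *
  have hz : ∀ k ∈ outer ν, ∀ n : ℤ, n * dArg k z (Pi.single j (Complex.I * z j)) =
      if k = j then (n : ℝ) else 0 := by
    intro k hk n
    rw [dArg_apply]
    by_cases h : k = j
    · subst h
      rw [Pi.single_eq_same, mul_div_cancel_right₀ _ (hne k hk)]
      simp
    · simp [h]
  have hs : ∀ n : Fin 8 → ℤ,
      ∑ k ∈ outer ν, n k * dArg k z (Pi.single j (Complex.I * z j)) =
        if j ∈ outer ν then (n j : ℝ) else 0 := fun n => by
    rw [Finset.sum_congr rfl fun k hk => hz k hk (n k), Finset.sum_ite_eq']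
  rw [hs, hs]
  have hν : ν ≠ ν + 1 := by simp
  by_cases h1 : j = ν
  · subst h1
    simp [mem_outer, a_self, b_self]
  by_cases h2 : j = ν + 1
  · subst h2
    simp [mem_outer, a_succ, b_succ]
  · rw [if_pos (mem_outer.2 ⟨h1, h2⟩), if_pos (mem_outer.2 ⟨h1, h2⟩),
      Pi.single_eq_of_ne (Ne.symm h1), Pi.single_eq_of_ne (Ne.symm h2)]
    ext1 <;> push_cast <;> ring

/-! ### The functions `J` and `H_t` -/

theorem J_eq : J = halfNormSq 0 := rfl

theorem contMDiff_halfNormSq (j : Fin 8) :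
    ContMDiff 𝓘(ℝ, ℂ × ℂ) 𝓘(ℝ, ℝ) ∞ (halfNormSq j) :=
  contMDiff_descend _ (contDiff_half_norm_sq j)

/-- The function on `ℂ⁸` that induces `H_t`. -/
def liftHt (t γ : ℝ) (z : Fin 8 → ℂ) : ℝ :=
  (1 - 2 * t) * (1 / 2 * ‖z 2‖ ^ 2) + t * γ * (Z z).re

theorem liftHt_smul (t γ : ℝ) (s : N) (z : Fin 8 → ℂ) : liftHt t γ (s • z) = liftHt t γ z := by
  simp only [liftHt, norm_smul_apply, Z_smul]

theorem Ht_eq (t γ : ℝ) : Ht t γ = descend (liftHt t γ) (liftHt_smul t γ) := by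
  funext p
  obtain ⟨z, rfl⟩ := isQuotientMap_tau.surjective p
  rfl

theorem contDiff_Z : ContDiff ℝ ∞ Z := by
  have h : ∀ k, ContDiff ℝ ∞ fun z : Fin 8 → ℂ => z k := fun k => contDiff_apply ℝ ℂ k
  have hs : ∀ k, ContDiff ℝ ∞ fun z : Fin 8 → ℂ => star (z k) := fun k =>
    Complex.conjCLE.contDiff.comp (h k)
  unfold Z
  exact (((((hs 1).mul (hs 2)).mul (hs 3)).mul (h 5)).mul (h 6)).mul (h 7)

theorem contDiff_liftHt (t γ : ℝ) : ContDiff ℝ ∞ (liftHt t γ) :=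
  (contDiff_const.mul (contDiff_half_norm_sq 2)).add
    (contDiff_const.mul (Complex.reCLM.contDiff.comp contDiff_Z))

theorem liftHt_rotate_zero (t γ : ℝ) (z : Fin 8 → ℂ) (s : ℝ) :
    liftHt t γ (rotate 0 z s) = liftHt t γ z := by
  simp [liftHt, Z, rotate]

theorem Z_rotate_two (z : Fin 8 → ℂ) (s : ℝ) :
    Z (rotate 2 z s) = star (Complex.exp (s * Complex.I) * star (Z z)) := by
  simp [Z, rotate]
  ring

theorem hasDerivAt_liftHt_rotate (t γ : ℝ) (z : Fin 8 → ℂ) :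
    HasDerivAt (fun s => liftHt t γ (rotate 2 z s)) (t * γ * (Z z).im) 0 := by
  have h : ∀ s, liftHt t γ (rotate 2 z s) = (1 - 2 * t) * (1 / 2 * ‖z 2‖ ^ 2) +
      t * γ * (Complex.exp (s * Complex.I) * star (Z z)).re := fun s => by
    rw [liftHt, norm_rotate, Z_rotate_two]
    rfl
  have h1 := Complex.reCLM.hasFDerivAt.comp_hasDerivAt 0 (hasDerivAt_exp_mul_I (star (Z z)))
  have h2 := (h1.const_mul (t * γ)).const_add ((1 - 2 * t) * (1 / 2 * ‖z 2‖ ^ 2))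
  simp only [h]
  refine h2.congr_deriv ?_
  simp

theorem differential_Ht_rotationField_zero (t γ : ℝ) (p : M) :
    SymplecticGeometry.differential (Ht t γ) p (rotationField 0 p) = 0 := by
  rw [Ht_eq]
  refine differential_rotationField _ (contDiff_liftHt t γ) 0 p ?_
  simp only [liftHt_rotate_zero]
  exact hasDerivAt_const _ _

theorem differential_Ht_rotationField_two (t γ : ℝ) (p : M) :
    SymplecticGeometry.differential (Ht t γ) p (rotationField 2 p) =
      t * γ * (Z (rep p)).im := by
  rw [Ht_eq]
  exact differential_rotationField _ (contDiff_liftHt t γ) 2 p (hasDerivAt_liftHt_rotate t γ _)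

theorem differential_J_rotationField_two (p : M) :
    SymplecticGeometry.differential J p (rotationField 2 p) = 0 := by
  refine differential_rotationField _ (contDiff_half_norm_sq 0) 2 p ?_
  simp only [norm_rotate]
  exact hasDerivAt_const _ _

theorem poissonBracket_eq (f g : M → ℝ) (p : M) :
    SymplecticGeometry.poissonBracket omega f g p =
      -modelForm (SymplecticGeometry.hamiltonianVectorField omega f p)
        (SymplecticGeometry.hamiltonianVectorField omega g p) := by
  rw [SymplecticGeometry.poissonBracket, omega_apply]

theorem poissonBracket_self (f : M → ℝ) (p : M) :
    SymplecticGeometry.poissonBracket omega f f p = 0 :=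
  (poissonBracket_eq f f p).trans (neg_eq_zero.2 (modelForm_self _))

theorem poissonBracket_Ht_J (t γ : ℝ) (p : M) :
    SymplecticGeometry.poissonBracket omega (Ht t γ) J p = 0 := by
  rw [poissonBracket_eq, J_eq, hamiltonianVectorField_halfNormSq,
    modelForm_hamiltonianVectorField, differential_Ht_rotationField_zero, neg_zero]

theorem poissonBracket_J_Ht (t γ : ℝ) (p : M) :
    SymplecticGeometry.poissonBracket omega J (Ht t γ) p = 0 := by
  have h := poissonBracket_Ht_J t γ p
  rw [poissonBracket_eq] at h
  refine (poissonBracket_eq J (Ht t γ) p).trans ?_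
  exact (congrArg Neg.neg (modelForm_swap _ _)).trans (neg_eq_zero.2 h)

/-! ### Linear independence almost everywhere -/

theorem combination_modelForm (r s : ℝ) (u u' v : ℂ × ℂ) :
    modelForm (r • u + s • u') v = r * modelForm u v + s * modelForm u' v := by
  simp [modelForm, cross]
  ring

theorem coefficients_eq_zero {ν : Fin 8} {A B x y : ℂ} (hA : A ≠ 0) (hB : B ≠ 0) (hx : x ≠ 0)
    (hy : y ≠ 0) {r s : ℝ}
    (h : r • (A * (a ν 0 * (Complex.I * x)), B * (b ν 0 * (Complex.I * y))) +
      s • (A * (a ν 2 * (Complex.I * x)), B * (b ν 2 * (Complex.I * y))) = 0) :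
    r = 0 ∧ s = 0 := by
  -- The determinant of `(v₁, v₃)` in the basis `(v_ν, v_{ν+1})`; both pairs have determinant 1.
  -- Cramer's rule then gives the conclusion.
  have hdet : ∀ ν, a ν 0 * b ν 2 - a ν 2 * b ν 0 = 1 := by decide
  have hdet' : (a ν 0 * b ν 2 - a ν 2 * b ν 0 : ℝ) = 1 := by exact_mod_cast hdet ν
  have h1 : (A * Complex.I * x) * ((r * a ν 0 + s * a ν 2 : ℝ) : ℂ) = 0 := by
    have := congrArg Prod.fst h
    simp only [Prod.fst_add, Prod.smul_fst, Complex.real_smul, Prod.fst_zero] at this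
    push_cast
    linear_combination this
  have h2 : (B * Complex.I * y) * ((r * b ν 0 + s * b ν 2 : ℝ) : ℂ) = 0 := by
    have := congrArg Prod.snd h
    simp only [Prod.snd_add, Prod.smul_snd, Complex.real_smul, Prod.snd_zero] at this
    push_cast
    linear_combination this
  have h1 : r * a ν 0 + s * a ν 2 = 0 := by
    exact_mod_cast (mul_eq_zero.1 h1).resolve_left
      (mul_ne_zero (mul_ne_zero hA Complex.I_ne_zero) hx)
  have h2 : r * b ν 0 + s * b ν 2 = 0 := by
    exact_mod_cast (mul_eq_zero.1 h2).resolve_left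
      (mul_ne_zero (mul_ne_zero hB Complex.I_ne_zero) hy)
  constructor
  · linear_combination (-r) * hdet' + b ν 2 * h1 - a ν 2 * h2
  · linear_combination (-s) * hdet' + a ν 0 * h2 - b ν 0 * h1

theorem coefficients_eq_zero_of_rotationField {p : M} (hp : ∀ k, rep p k ≠ 0) {r s : ℝ}
    (h : r • (rotationField 0 p : ℂ × ℂ) + s • (rotationField 2 p : ℂ × ℂ) = 0) :
    r = 0 ∧ s = 0 := by
  rw [rotationField_eq, rotationField_eq] at h
  have hn : ∀ n : Fin 8 → ℤ,
      ∏ k ∈ outer (chartIndex p), (rep p k / (‖rep p k‖ : ℂ)) ^ n k ≠ 0 := fun n =>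
    Finset.prod_ne_zero_iff.2 fun k _ => zpow_ne_zero _
      (div_ne_zero (hp k) (by exact_mod_cast norm_ne_zero_iff.2 (hp k)))
  exact coefficients_eq_zero (hn _) (hn _) (hp _) (hp _) h

theorem Ht_zero (γ : ℝ) : Ht 0 γ = halfNormSq 2 := by
  funext p
  simp [Ht]
  rfl

theorem linearIndependent_hamiltonianVectorField (t : ℝ) {γ : ℝ} (hγ : γ ≠ 0) {p : M}
    (hp : ∀ k, rep p k ≠ 0) (hZ : (Z (rep p)).im ≠ 0) :
    LinearIndependent ℝ fun i =>
      SymplecticGeometry.hamiltonianVectorField omega (![J, Ht t γ] i) p := by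
  have hpair : LinearIndependent ℝ
      ![(SymplecticGeometry.hamiltonianVectorField omega J p : ℂ × ℂ),
        (SymplecticGeometry.hamiltonianVectorField omega (Ht t γ) p : ℂ × ℂ)] := by
    rw [LinearIndependent.pair_iff]
    intro r s h
    by_cases ht : t = 0
    · subst ht
      rw [Ht_zero, J_eq, hamiltonianVectorField_halfNormSq,
        hamiltonianVectorField_halfNormSq] at h
      exact coefficients_eq_zero_of_rotationField hp h
    -- Pairing the relation with the rotation of `z₃` kills the `J` term and leaves `s · tγ Im Z =
    -- 0`.
    · have h1 := (congrArg (fun u => modelForm u (rotationField 2 p)) h).symm.trans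
        (combination_modelForm r s
          (SymplecticGeometry.hamiltonianVectorField omega J p)
          (SymplecticGeometry.hamiltonianVectorField omega (Ht t γ) p) (rotationField 2 p))
      rw [modelForm_hamiltonianVectorField, modelForm_hamiltonianVectorField,
        differential_J_rotationField_two, differential_Ht_rotationField_two, mul_zero,
        zero_add] at h1
      have h0 : modelForm 0 (rotationField 2 p) = 0 := by simp [modelForm, cross]
      have hs : s = 0 :=
        (mul_eq_zero.1 (h1.symm.trans h0)).resolve_right (mul_ne_zero (mul_ne_zero ht hγ) hZ)
      subst hs
      rw [J_eq, hamiltonianVectorField_halfNormSq, zero_smul] at h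
      exact coefficients_eq_zero_of_rotationField hp (s := 0) (by rw [zero_smul]; exact h)
  convert hpair using 1
  funext i
  fin_cases i <;> rfl

/-- A closed null set in `ℂ²` outside of which all coordinates of the local sections and the
imaginary part of `Z` are nonzero. -/
def exceptionalSet : Set (ℂ × ℂ) := {x | x.1.im = 0 ∨ x.2.im = 0 ∨ (x.1 * x.2).im = 0}

theorem localSection_generic {ν : Fin 8} {x : ℂ × ℂ} (hx : x ∈ V ν) (hx' : x ∉ exceptionalSet) :
    (∀ k, localSection ν x k ≠ 0) ∧ (Z (localSection ν x)).im ≠ 0 := by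
  simp only [exceptionalSet, Set.mem_ofPred_eq, not_or] at hx'
  obtain ⟨h1, h2, h12⟩ := hx'
  have hx1 : x.1 ≠ 0 := fun h => h1 (by rw [h, Complex.zero_im])
  have hx2 : x.2 ≠ 0 := fun h => h2 (by rw [h, Complex.zero_im])
  have hne : ∀ k, localSection ν x k ≠ 0 := by
    intro k
    by_cases hk1 : k = ν
    · rwa [hk1, localSection_self]
    by_cases hk2 : k = ν + 1
    · rwa [hk2, localSection_succ]
    · exact localSection_ne_zero hx k (mem_outer.2 ⟨hk1, hk2⟩)
  refine ⟨hne, ?_⟩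
  have e1 := localSection_self ν x
  have e2 := localSection_succ ν x
  obtain ⟨r, hr⟩ : ∃ r : Fin 8 → ℝ, ∀ k ∈ outer ν, localSection ν x k = r k :=
    ⟨_, fun k hk => localSection_outer hk x⟩
  have hr0 : ∀ k ∈ outer ν, r k ≠ 0 := fun k hk h => hne k (by rw [hr k hk, h, Complex.ofReal_zero])
  have him : ∀ (s : ℝ) (w : ℂ), s ≠ 0 → w.im ≠ 0 → ((s : ℂ) * w).im ≠ 0 := fun s w hs hw => by
    rw [Complex.im_ofReal_mul]
    exact mul_ne_zero hs hw
  have hs1 : (star x.1).im ≠ 0 := neg_ne_zero.2 h1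
  have hs2 : (star x.2).im ≠ 0 := neg_ne_zero.2 h2
  have hs12 : (star (x.1 * x.2)).im ≠ 0 := neg_ne_zero.2 h12
  generalize localSection ν x = z at *
  clear hx hne
  -- `Z` omits `z₁` and `z₅`, which are not adjacent, so at least one chart coordinate enters `Z`.
  -- When both do, they are both conjugated or both not, since the two groups of factors are
  -- separated by `z₁` and `z₅`.
  have key : ∃ (s : ℝ) (w : ℂ), s ≠ 0 ∧ w.im ≠ 0 ∧ Z z = s * w := by
    have hcases : ∀ ν : Fin 8, ν = 0 ∨ ν = 1 ∨ ν = 2 ∨ ν = 3 ∨ ν = 4 ∨ ν = 5 ∨ ν = 6 ∨ ν = 7 := by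
      decide
    rcases hcases ν with rfl | rfl | rfl | rfl | rfl | rfl | rfl | rfl
    · change z 1 = x.2 at e2
      refine ⟨r 2 * r 3 * r 5 * r 6 * r 7, star x.2, ?_, hs2, ?_⟩
      · simp [hr0 2 (by decide), hr0 3 (by decide), hr0 5 (by decide), hr0 6 (by decide), hr0 7 (by decide)]
      · simp [Z, e2, hr 2 (by decide), hr 3 (by decide), hr 5 (by decide), hr 6 (by decide), hr 7 (by decide)]
        ring
    · change z 2 = x.2 at e2
      refine ⟨r 3 * r 5 * r 6 * r 7, star (x.1 * x.2), ?_, hs12, ?_⟩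
      · simp [hr0 3 (by decide), hr0 5 (by decide), hr0 6 (by decide), hr0 7 (by decide)]
      · simp [Z, e1, e2, hr 3 (by decide), hr 5 (by decide), hr 6 (by decide), hr 7 (by decide)]
        ring
    · change z 3 = x.2 at e2
      refine ⟨r 1 * r 5 * r 6 * r 7, star (x.1 * x.2), ?_, hs12, ?_⟩
      · simp [hr0 1 (by decide), hr0 5 (by decide), hr0 6 (by decide), hr0 7 (by decide)]
      · simp [Z, e1, e2, hr 1 (by decide), hr 5 (by decide), hr 6 (by decide), hr 7 (by decide)]
        ring
    · change z 4 = x.2 at e2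
      refine ⟨r 1 * r 2 * r 5 * r 6 * r 7, star x.1, ?_, hs1, ?_⟩
      · simp [hr0 1 (by decide), hr0 2 (by decide), hr0 5 (by decide), hr0 6 (by decide), hr0 7 (by decide)]
      · simp [Z, e1, hr 1 (by decide), hr 2 (by decide), hr 5 (by decide), hr 6 (by decide), hr 7 (by decide)]
        ring
    · change z 5 = x.2 at e2
      refine ⟨r 1 * r 2 * r 3 * r 6 * r 7, x.2, ?_, h2, ?_⟩
      · simp [hr0 1 (by decide), hr0 2 (by decide), hr0 3 (by decide), hr0 6 (by decide), hr0 7 (by decide)]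
      · simp [Z, e2, hr 1 (by decide), hr 2 (by decide), hr 3 (by decide), hr 6 (by decide), hr 7 (by decide)]
        ring
    · change z 6 = x.2 at e2
      refine ⟨r 1 * r 2 * r 3 * r 7, x.1 * x.2, ?_, h12, ?_⟩
      · simp [hr0 1 (by decide), hr0 2 (by decide), hr0 3 (by decide), hr0 7 (by decide)]
      · simp [Z, e1, e2, hr 1 (by decide), hr 2 (by decide), hr 3 (by decide), hr 7 (by decide)]
        ring
    · change z 7 = x.2 at e2
      refine ⟨r 1 * r 2 * r 3 * r 5, x.1 * x.2, ?_, h12, ?_⟩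
      · simp [hr0 1 (by decide), hr0 2 (by decide), hr0 3 (by decide), hr0 5 (by decide)]
      · simp [Z, e1, e2, hr 1 (by decide), hr 2 (by decide), hr 3 (by decide), hr 5 (by decide)]
        ring
    · change z 0 = x.2 at e2
      refine ⟨r 1 * r 2 * r 3 * r 5 * r 6, x.1, ?_, h1, ?_⟩
      · simp [hr0 1 (by decide), hr0 2 (by decide), hr0 3 (by decide), hr0 5 (by decide), hr0 6 (by decide)]
      · simp [Z, e1, hr 1 (by decide), hr 2 (by decide), hr 3 (by decide), hr 5 (by decide), hr 6 (by decide)]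
  obtain ⟨s, w, hs, hw, h⟩ := key
  rw [h]
  exact him s w hs hw

theorem volume_im_mul_eq_zero {w : ℂ} (hw : w ≠ 0) :
    volume {y : ℂ | (w * y).im = 0} = 0 := by
  let S : Submodule ℝ ℂ := (Complex.imLm ∘ₗ LinearMap.mulLeft ℝ w).ker
  refine Measure.addHaar_submodule volume S fun h => ?_
  have hmem : w⁻¹ * Complex.I ∈ S := h ▸ Submodule.mem_top
  simp [S, hw] at hmem

theorem volume_exceptionalSet : volume exceptionalSet = 0 := by
  have hc : IsClosed exceptionalSet := by
    refine (isClosed_eq (by fun_prop) continuous_const).union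
      ((isClosed_eq (by fun_prop) continuous_const).union
        (isClosed_eq (by fun_prop) continuous_const))
  rw [Measure.volume_eq_prod, Measure.measure_prod_null hc.measurableSet]
  have h0 := volume_im_mul_eq_zero one_ne_zero
  simp only [one_mul] at h0
  have hae : ∀ᵐ w : ℂ, w.im ≠ 0 := measure_eq_zero_iff_ae_notMem.1 h0
  -- By Fubini it suffices that almost every slice is null: for `Im w ≠ 0` it lies in the union of
  -- the real lines `Im y = 0` and `Im (w y) = 0`.
  filter_upwards [hae] with w hw
  have hw0 : w ≠ 0 := fun h => hw (by rw [h, Complex.zero_im])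
  refine measure_mono_null ?_ (measure_union_null h0 (volume_im_mul_eq_zero hw0))
  intro y hy
  exact (hy : _ ∨ _).resolve_left hw

theorem isNull_dependent (t : ℝ) {γ : ℝ} (hγ : γ ≠ 0) :
    SymplecticGeometry.IsNull (ℂ × ℂ) {p : M | ¬ LinearIndependent ℝ fun i =>
      SymplecticGeometry.hamiltonianVectorField omega (![J, Ht t γ] i) p} := by
  rintro _ ⟨ν, rfl⟩ μ hμ
  have : (volume : Measure (ℂ × ℂ)).IsAddHaarMeasure := Measure.prod.instIsAddHaarMeasure _ _
  have hμ0 : μ exceptionalSet = 0 :=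
    Measure.absolutelyContinuous_isAddHaarMeasure μ volume volume_exceptionalSet
  refine measure_mono_null ?_ hμ0
  rintro _ ⟨p, ⟨hp, hpU⟩, rfl⟩
  by_contra hx
  have hV : chart ν p ∈ V ν := chart_mem_V hpU
  obtain ⟨hne, hZ⟩ := localSection_generic hV hx
  -- The chart `ν` need not be the preferred one at `p`. The two representatives lie in one
  -- `N`-orbit, and the genericity conditions depend only on the invariants `Z` and `|z_k|`.
  have heq : tau ⟨rep p, rep_mem p⟩ = tau ⟨localSection ν (chart ν p), localSection_mem hV⟩ := by
    rw [tau_rep, ← chart_symm_apply hV]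
    exact ((chart ν).left_inv hpU).symm
  have hZ' : Z (rep p) = Z (localSection ν (chart ν p)) := congrArg (descend Z Z_smul) heq
  have hn : ∀ k, ‖rep p k‖ = ‖localSection ν (chart ν p) k‖ := fun k =>
    congrArg (descend (fun z => ‖z k‖) fun t z => norm_smul_apply t z k) heq
  refine hp (linearIndependent_hamiltonianVectorField t hγ (fun k => ?_) (hZ' ▸ hZ))
  rw [← norm_ne_zero_iff, hn, norm_ne_zero_iff]
  exact hne k

end Octagon

end

theorem mainTheorem10 (t γ : ℝ) (hγ : γ ≠ 0) :
    Octagon.IsReducedForm Octagon.omega ∧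
      SymplecticGeometry.IsCompletelyIntegrableSystem Octagon.omega
        ![Octagon.J, Octagon.Ht t γ] := by
  refine ⟨Octagon.isReducedForm_omega, inferInstance, ?_, Octagon.isSymplecticManifold_omega, ?_,
    ?_, Octagon.isNull_dependent t hγ⟩
  · simp [Module.finrank_prod, Complex.finrank_real_complex]
  · rw [Fin.forall_fin_two]
    refine ⟨Octagon.contMDiff_halfNormSq 0, ?_⟩
    rw [Matrix.cons_val_one, Matrix.cons_val_fin_one, Octagon.Ht_eq]
    exact Octagon.contMDiff_descend _ (Octagon.contDiff_liftHt t γ)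
  · rw [Fin.forall_fin_two, Fin.forall_fin_two, Fin.forall_fin_two]
    exact ⟨⟨Octagon.poissonBracket_self _, Octagon.poissonBracket_J_Ht t γ⟩,
      Octagon.poissonBracket_Ht_J t γ, Octagon.poissonBracket_self _⟩
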